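/- \textbf{Setting (online learning of quantum states with log loss).} Let $d\ge 1$ and let $\mathcal A$ be the set of quantum states, i.e. of positive semidefinite Hermitian $d\times d$ matrices $X$ with $\operatorname{Tr}X=1$; write $\langle X,Y\rangle=\operatorname{Tr}(X^*Y)$. In each round $t=1,\dots,T$ the learner plays $X_t\in\mathcal A$, then observes an arbitrary loss matrix $R_t\in\mathcal A$, and suffers $f_t(X_t)$, where $f_t(X)=-\log\langle X,R_t\rangle$ (with value $+\infty$ if $\langle X,R_t\rangle=0$). The regret is $$\operatorname{Reg}=\max_{U\in\mathcal A}\ \sum_{t=1}^T\bigl(f_t(X_t)-f_t(U)\bigr).$$ \textbf{Algorithm (Schr\"odinger's-BISONS).} Parameters: $B=\frac{264}{5}d^2\log T$, $\eta=\frac1{4B}$, $\beta=\frac{11d}{7B}$. Let $\mathcal R(X)=-\log\det X$ (with value $+\infty$ at singular $X$). The algorithm runs in epochs with an internal time $\tau$. At the start of an epoch, $\tau=1$, $\hat F_0=G_0=\eta^{-1}\mathcal R$, $X^{(1)}=U^{(1)}=\arg\min_{X\in\mathcal A}G_0(X)$, $P_0=d\,I$, and $P_1$ is obtained from $P_0$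 and $X^{(1)}$ by the update rule for $P$ below with $\tau=0$. In each round $t$, at internal time $\tau$, the algorithm plays $X_t=X^{(\tau)}$, observes $R_t$, and with $\nabla f_t(X_t)=-R_t/\langle X_t,R_t\rangle$ it sets \begin{align*} \hat f_\tau(X)&=f_t(X_t)+\langle X-X_t,\nabla f_t(X_t)\rangle+\tfrac{\beta}{2}\langle X-X_t,\nabla f_t(X_t)\rangle^2,\\ \hat F_\tau&=\hat F_{\tau-1}+\hat f_\tau,\qquad G_\tau(X)=G_{\tau-1}(X)+\hat f_\tau(X)-\langle X,P_\tau-P_{\tau-1}\rangle B,\\ X^{(\tau+1)}&=\arg\min_{X\in\mathcal A}G_\tau(X),\qquad U^{(\tau+1)}=\arg\min_{X\in\mathcal A}\hat F_\tau(X),\\ P_{\tau+1}&=P_\tau+S^{-1}\bigl(I-S P_\tau S\bigr)_+S^{-1},\qquad S=(X^{(\tau+1)})^{1/2}, \end{align*} where $(\cdot)_+$ replaces the negative eigenvalues of a Hermitian matrix by $0$. If $U^{(\tau+1)}\not\prec\frac{1}{2(1+6\eta)\beta}P_{\tau+1}^{-1}$, a new epoch is started (all memory is reset and $\tau=1$);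 otherwise $\tau$ is increased by $1$. \textbf{Claim.} There is a universal constant $C$ such that for all $d\ge1$, all $T\ge110d^2$ and all sequences $R_1,\dots,R_T\in\mathcal A$, the regret of this algorithm satisfies $$\operatorname{Reg}\le C\,d^3\log^2 T .$$ -/

import Mathlib

open scoped Matrix ComplexOrder

noncomputable section

namespace QuantumBISONS

/-- Complex `d × d` matrices. -/
abbrev Mat (d : ℕ) : Type := Matrix (Fin d) (Fin d) ℂ

/-- The inner product `⟨X, Y⟩ = Tr(X* Y)`; it is a real number when `X` and `Y` are Hermitian. -/
def ip {d : ℕ} (X Y : Mat d) : ℝ := (Xᴴ * Y).trace.re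

/-- The action set `𝒜`: quantum states, i.e. positive semidefinite Hermitian matrices of
trace one. -/
def states (d : ℕ) : Set (Mat d) := {X | X.PosSemidef ∧ X.trace = 1}

/-- `-log x` for `x ≥ 0` with its true value `+∞` at `x = 0`. -/
def negLog (x : ℝ) : EReal := -ENNReal.log (ENNReal.ofReal x)

theorem negLog_of_pos {x : ℝ} (hx : 0 < x) : negLog x = ((-Real.log x : ℝ) : EReal) := by
  rw [negLog, ENNReal.log_ofReal_of_pos hx, EReal.coe_neg]

theorem negLog_zero : negLog 0 = ⊤ := by
  simp [negLog]

/-- The log loss `f(X; R) = -log ⟨X, R⟩`, equal to `+∞` when `⟨X, R⟩ = 0`. -/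
def loss {d : ℕ} (X R : Mat d) : EReal := negLog (ip X R)

/-- The log-det barrier `-log det X`, equal to `+∞` at singular states. -/
def logDetBarrier {d : ℕ} (X : Mat d) : EReal := negLog X.det.re

/-- The gradient `-R / ⟨X, R⟩` of the log loss `f(·; R)` at a point with `⟨X, R⟩ > 0`;
see `hasDerivAt_loss`. -/
def lossGrad {d : ℕ} (X R : Mat d) : Mat d := -((ip X R)⁻¹ • R)

theorem hasDerivAt_loss {d : ℕ} (X R M : Mat d) (h : 0 < ip X R) :
    HasDerivAt (fun s : ℝ => -Real.log (ip (X + s • M) R)) (ip M (lossGrad X R)) 0 := by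
  have hlin : ∀ s : ℝ, ip (X + s • M) R = ip X R + s * ip M R := by
    intro s
    simp [ip, Matrix.conjTranspose_add, Matrix.conjTranspose_smul, add_mul, Matrix.trace_add]
  have hg : ip M (lossGrad X R) = -(ip M R / ip X R) := by
    rw [lossGrad, div_eq_inv_mul]
    generalize (ip X R)⁻¹ = c
    simp [ip]
  simp only [hlin]
  rw [hg]
  have h1 : HasDerivAt (fun s : ℝ => ip X R + s * ip M R) (ip M R) 0 := by
    simpa using ((hasDerivAt_id (0 : ℝ)).mul_const (ip M R)).const_add (ip X R)
  have h2 := (h1.log (by simpa using h.ne')).fun_neg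
  simpa using h2

/-- The quadratic surrogate
`f̂(X) = f(Y) + ⟨X - Y, ∇f(Y)⟩ + (β / 2) ⟨X - Y, ∇f(Y)⟩²` of `f(·; R)` around the played
state `Y`, where `⟨Y, R⟩ > 0`. -/
def surrogate {d : ℕ} (β : ℝ) (Y R : Mat d) (X : Mat d) : ℝ :=
  -Real.log (ip Y R) + ip (X - Y) (lossGrad Y R) + β / 2 * ip (X - Y) (lossGrad Y R) ^ 2

/-- `argmin_{X ∈ 𝒜} G(X)`: a minimizer of `G` over the quantum states (if there is any). -/
def argminStates {d : ℕ} (G : Mat d → EReal) : Mat d :=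
  Classical.epsilon fun X => X ∈ states d ∧ IsMinOn G (states d) X

/-- The square root `X^{1/2}` of a positive semidefinite matrix (spectral calculus). -/
def msqrt {d : ℕ} (X : Mat d) : Mat d := cfc Real.sqrt X

/-- The positive part `M₊` of a Hermitian matrix: negative eigenvalues are set to zero. -/
def mposPart {d : ℕ} (M : Mat d) : Mat d := cfc (fun x : ℝ => max x 0) M

/-- The bias update `P ↦ P + X^{-1/2} (I - X^{1/2} P X^{1/2})₊ X^{-1/2}`. -/
def biasUpdate {d : ℕ} (P X : Mat d) : Mat d :=
  P + (msqrt X)⁻¹ * mposPart (1 - msqrt X * P * msqrt X) * (msqrt X)⁻¹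

/-- The memory of the algorithm at internal time `τ` of an epoch: `X_τ`, `U_τ`, `P_{τ-1}`,
`P_τ`, and the functions `F̂_{τ-1}`, `G_{τ-1}`. -/
structure State (d : ℕ) where
  X : Mat d
  U : Mat d
  Pprev : Mat d
  P : Mat d
  F : Mat d → EReal
  G : Mat d → EReal

/-- The memory at the beginning of an epoch (`τ = 1`): `F̂_0 = G_0 = η⁻¹ R` with `R` the
log-det barrier, `X_1 = U_1 = argmin G_0`, `P_0 = d I`, and `P_1` by the update rule. -/
def initState (d : ℕ) (η : ℝ) : State d :=
  let G₀ : Mat d → EReal := fun X => ((η⁻¹ : ℝ) : EReal) * logDetBarrier X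
  let X₁ : Mat d := argminStates G₀
  let P₀ : Mat d := (d : ℝ) • (1 : Mat d)
  { X := X₁, U := X₁, Pprev := P₀, P := biasUpdate P₀ X₁, F := G₀, G := G₀ }

open Classical in
/-- One round, after the loss matrix `R` has been observed. The algorithm resets unless
`U_{τ+1} ≺ (2 (1 + 6 η) β)⁻¹ P_{τ+1}⁻¹`. -/
def step {d : ℕ} (B η β : ℝ) (s : State d) (R : Mat d) : State d :=
  let fhat : Mat d → ℝ := surrogate β s.X R
  let g : Mat d → ℝ := fun X => fhat X - ip X (s.P - s.Pprev) * B
  let F' : Mat d → EReal := fun X => s.F X + (fhat X : EReal)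
  let G' : Mat d → EReal := fun X => s.G X + (g X : EReal)
  let X' : Mat d := argminStates G'
  let U' : Mat d := argminStates F'
  let P' : Mat d := biasUpdate s.P X'
  if ((2 * (1 + 6 * η) * β)⁻¹ • P'⁻¹ - U').PosDef then
    { X := X', U := U', Pprev := s.P, P := P', F := F', G := G' }
  else
    initState d η

/-- The memory at the start of round `t` (rounds are numbered `0, 1, 2, …`) when the loss
matrices are `R 0, R 1, …`; it depends on `R 0, …, R (t - 1)` only. -/
def stateAt {d : ℕ} (B η β : ℝ) (R : ℕ → Mat d) : ℕ → State d
  | 0 => initState d η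
  | t + 1 => step B η β (stateAt B η β R t) (R t)

/-- The bias scale `B = (264 / 5) d² log T`. -/
def biasScale (d T : ℕ) : ℝ := 264 / 5 * (d : ℝ) ^ 2 * Real.log T

/-- The learning rate `η = 1 / (4 B)`. -/
def learningRate (d T : ℕ) : ℝ := 1 / (4 * biasScale d T)

/-- The curvature parameter `β = 11 d / (7 B)`. -/
def curvature (d T : ℕ) : ℝ := 11 * (d : ℝ) / (7 * biasScale d T)

/-- The state played in round `t` by the algorithm tuned for horizon `T`. -/
def play {d : ℕ} (T : ℕ) (R : ℕ → Mat d) (t : ℕ) : Mat d :=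
  (stateAt (biasScale d T) (learningRate d T) (curvature d T) R t).X

/-- `Reg(U) = ∑_t (f_t(X_t) - f_t(U))`, the regret over the first `T` rounds against the fixed
state `U`. It is `-∞` if `U` suffers an infinite loss. -/
def regretAgainst {d : ℕ} (T : ℕ) (R : ℕ → Mat d) (U : Mat d) : EReal :=
  ∑ t ∈ Finset.range T, (loss (play T R t) (R t) - loss U (R t))

/-- The regret against the best quantum state in hindsight. -/
def regret {d : ℕ} (T : ℕ) (R : ℕ → Mat d) : EReal :=
  ⨆ U ∈ states d, regretAgainst T R U

end QuantumBISONS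

end

/-!
# Logarithmic regret of Schrödinger's-BISONS

The algorithm is follow-the-regularized-leader with the log-det barrier on quadratic surrogates
`f̂` of the log losses, plus a bias `-B ⟨X, P⟩`, where `P` dominates the inverse of every state
played in the current epoch. Throughout, `log det` is handled through one spectral inequality,
`log det H ≤ tr H - d`, in the sharpened form `logDet_add_frobSq_le`.

*Regret on surrogates* (`IsEpoch.played_loss_le`). Consecutive states are multiplicatively
`6 η`-close (`IsEpoch.gap_le`): a step of local size `ρ` makes the next bias increment at most `ρ`
in Frobenius norm, and since `B η = 1 / 4` such an increment together with a gradient of local norm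
at most one moves the next state by at most `6 η` again. The stability cost of a round then splits
into an online Newton step term, which telescopes through the log-determinant of a second-moment
matrix on `ℂ^{d × d}` (`online_newton_potential`), and a fraction of the trace of the bias gap. That
trace is the bias paid by the learner, and it telescopes into `log det P` (`rtr_biasGap_le`).

*From surrogates to losses* (`IsEpoch.surrogate_min_le`). While the algorithm does not reset, the
comparator `U`, which minimizes the surrogate objective, is below `X / (2 β)` for all states `X`
played in the epoch. In that region the tangent of each surrogate minorizes the true loss on all
states (`surrogate_tangent_le`), so by convexity the surrogate minimum is at most the true
regularized loss of every state. The same bound on the gradients keeps `U` away from the boundary,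
hence `P` is polynomially bounded (`IsEpoch.rtr_bias_le_sq`).

*Resets* (`IsEpoch.regret_nonpos`). If the condition fails for the new comparator `U` and the new
bias, then `B ⟨U, P⟩` is at least of order `B / β`, hence of order `d³ log² T`, with a constant
that exceeds all costs of the epoch. Thus finished epochs have nonpositive regret, and only the
last, unfinished one contributes, with `O(d³ log² T)` (`IsEpoch.regret_le`).
-/

noncomputable section

namespace QuantumBISONS

/-! ### Traces and log-determinants of positive matrices -/

section Matrices

variable {ι : Type*}

lemma posSemidef_sub_trans {A B C : Matrix ι ι ℂ} (h : (B - A).PosSemidef)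
    (h' : (C - B).PosSemidef) : (C - A).PosSemidef := by
  have := h'.add h
  rwa [sub_add_sub_cancel] at this

variable [Fintype ι]

/-- The real part of the trace. -/
def rtr (A : Matrix ι ι ℂ) : ℝ := A.trace.re

lemma rtr_add (A B : Matrix ι ι ℂ) : rtr (A + B) = rtr A + rtr B := by
  simp [rtr, Matrix.trace_add]

lemma rtr_sub (A B : Matrix ι ι ℂ) : rtr (A - B) = rtr A - rtr B := by
  simp [rtr, Matrix.trace_sub]

lemma rtr_smul (c : ℝ) (A : Matrix ι ι ℂ) : rtr (c • A) = c * rtr A := by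
  simp [rtr, Matrix.trace_smul]

lemma rtr_mul_comm (A B : Matrix ι ι ℂ) : rtr (A * B) = rtr (B * A) := by
  rw [rtr, Matrix.trace_mul_comm, rtr]

lemma rtr_one [DecidableEq ι] : rtr (1 : Matrix ι ι ℂ) = Fintype.card ι := by
  simp [rtr]

lemma rtr_nonneg {A : Matrix ι ι ℂ} (hA : A.PosSemidef) : 0 ≤ rtr A :=
  (Complex.le_def.1 hA.trace_nonneg).1

lemma rtr_le_of_sub {A B : Matrix ι ι ℂ} (h : (B - A).PosSemidef) : rtr A ≤ rtr B := by
  have := rtr_nonneg h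
  rw [rtr_sub] at this
  linarith

/-- The squared Frobenius norm. -/
def frobSq (A : Matrix ι ι ℂ) : ℝ := rtr (Aᴴ * A)

lemma frobSq_nonneg (A : Matrix ι ι ℂ) : 0 ≤ frobSq A :=
  rtr_nonneg (Matrix.posSemidef_conjTranspose_mul_self A)

lemma frobSq_eq_sum (A : Matrix ι ι ℂ) : frobSq A = ∑ i, ∑ j, ‖A j i‖ ^ 2 := by
  simp only [frobSq, rtr, Matrix.trace, Matrix.diag_apply, Matrix.mul_apply,
    Matrix.conjTranspose_apply, Complex.re_sum]
  refine Finset.sum_congr rfl fun i _ => Finset.sum_congr rfl fun j _ => ?_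
  rw [Complex.sq_norm, Complex.normSq_apply]
  simp

lemma norm_sq_le_frobSq (A : Matrix ι ι ℂ) (i j : ι) : ‖A i j‖ ^ 2 ≤ frobSq A := by
  rw [frobSq_eq_sum]
  calc ‖A i j‖ ^ 2 ≤ ∑ k, ‖A k j‖ ^ 2 :=
        Finset.single_le_sum (f := fun k => ‖A k j‖ ^ 2) (fun _ _ => by positivity)
          (Finset.mem_univ i)
    _ ≤ _ := Finset.single_le_sum (f := fun l => ∑ k, ‖A k l‖ ^ 2)
          (fun _ _ => by positivity) (Finset.mem_univ j)

lemma frobSq_of_isHermitian {A : Matrix ι ι ℂ} (hA : A.IsHermitian) :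
    frobSq A = rtr (A * A) := by
  rw [frobSq, hA.eq]

lemma frobSq_eq_zero {A : Matrix ι ι ℂ} (h : frobSq A = 0) : A = 0 := by
  ext i j
  have := norm_sq_le_frobSq A i j
  rw [h] at this
  have h2 : ‖A i j‖ = 0 := by nlinarith [norm_nonneg (A i j)]
  simpa using h2

/-- Cauchy–Schwarz for the real trace inner product of Hermitian matrices. -/
lemma rtr_mul_sq_le {A B : Matrix ι ι ℂ} (hA : A.IsHermitian) (hB : B.IsHermitian) :
    rtr (A * B) ^ 2 ≤ frobSq A * frobSq B := by
  have key : ∀ t : ℝ, 0 ≤ frobSq B * (t * t) + 2 * rtr (A * B) * t + frobSq A := by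
    intro t
    have hH : (A + t • B).IsHermitian :=
      hA.add (by simp [Matrix.IsHermitian, Matrix.conjTranspose_smul, hB.eq])
    have h := frobSq_nonneg (A + t • B)
    rw [frobSq_of_isHermitian hH] at h
    have e : (A + t • B) * (A + t • B) = A * A + t • (A * B) + (t • (B * A) + t • t • (B * B)) := by
      simp only [add_mul, mul_add, smul_mul_assoc, mul_smul_comm, smul_add]
      abel
    rw [e] at h
    simp only [rtr_add, rtr_smul] at h
    rw [rtr_mul_comm B A] at h
    rw [frobSq_of_isHermitian hA, frobSq_of_isHermitian hB]
    linarith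
  have := discrim_le_zero key
  rw [discrim] at this
  nlinarith

lemma abs_rtr_mul_le {A B : Matrix ι ι ℂ} (hA : A.IsHermitian) (hB : B.IsHermitian) :
    |rtr (A * B)| ≤ √(frobSq A) * √(frobSq B) := by
  rw [← Real.sqrt_mul (frobSq_nonneg A)]
  exact Real.abs_le_sqrt (rtr_mul_sq_le hA hB)

lemma conj_posSemidef {A S : Matrix ι ι ℂ} (hA : A.PosSemidef) (hS : S.IsHermitian) :
    (S * A * S).PosSemidef := by
  have := hA.conjTranspose_mul_mul_same S
  rwa [hS.eq] at this

variable [DecidableEq ι]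

open scoped MatrixOrder in
lemma exists_posSemidef_sq {A : Matrix ι ι ℂ} (hA : A.PosSemidef) :
    ∃ S : Matrix ι ι ℂ, S.PosSemidef ∧ S * S = A := by
  refine ⟨CFC.sqrt A, Matrix.nonneg_iff_posSemidef.1 (CFC.sqrt_nonneg A), ?_⟩
  exact CFC.sqrt_mul_sqrt_self A (Matrix.nonneg_iff_posSemidef.2 hA)

lemma rtr_mul_nonneg {A B : Matrix ι ι ℂ} (hA : A.PosSemidef) (hB : B.PosSemidef) :
    0 ≤ rtr (A * B) := by
  obtain ⟨S, hS, rfl⟩ := exists_posSemidef_sq hB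
  rw [← mul_assoc, rtr_mul_comm, ← mul_assoc]
  exact rtr_nonneg (conj_posSemidef hA hS.1)

lemma rtr_mul_le_of_sub {A B C : Matrix ι ι ℂ} (h : (B - A).PosSemidef) (hC : C.PosSemidef) :
    rtr (A * C) ≤ rtr (B * C) := by
  have := rtr_mul_nonneg h hC
  rw [sub_mul, rtr_sub] at this
  linarith

lemma smul_one_sub_posSemidef_of_eigenvalues {A : Matrix ι ι ℂ} (hA : A.IsHermitian) {c : ℝ}
    (h : ∀ i, hA.eigenvalues i ≤ c) : (c • (1 : Matrix ι ι ℂ) - A).PosSemidef := by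
  have hU : (hA.eigenvectorUnitary : Matrix ι ι ℂ) * star (hA.eigenvectorUnitary : Matrix ι ι ℂ)
      = 1 := by simp
  have e : c • (1 : Matrix ι ι ℂ) - A = (hA.eigenvectorUnitary : Matrix ι ι ℂ) *
      (Matrix.diagonal fun i => ((c - hA.eigenvalues i : ℝ) : ℂ)) *
      star (hA.eigenvectorUnitary : Matrix ι ι ℂ) := by
    conv_lhs => rw [hA.spectral_theorem, Unitary.conjStarAlgAut_apply]
    have e2 : (Matrix.diagonal fun i => ((c - hA.eigenvalues i : ℝ) : ℂ)) =
        c • (1 : Matrix ι ι ℂ) - Matrix.diagonal (RCLike.ofReal ∘ hA.eigenvalues) := by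
      ext i j
      by_cases hij : i = j
      · subst hij; simp
      · simp [hij]
    rw [e2, mul_sub, sub_mul, mul_smul_comm, smul_mul_assoc, mul_one, hU]
  rw [e]
  refine Matrix.PosSemidef.mul_mul_conjTranspose_same (Matrix.PosSemidef.diagonal ?_) _
  intro i
  simpa using h i

lemma rtr_eq_sum_eigenvalues {A : Matrix ι ι ℂ} (hA : A.IsHermitian) :
    rtr A = ∑ i, hA.eigenvalues i := by
  rw [rtr, hA.trace_eq_sum_eigenvalues]
  simp

lemma rtr_sq_eq_sum_eigenvalues {A : Matrix ι ι ℂ} (hA : A.IsHermitian) :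
    rtr (A * A) = ∑ i, hA.eigenvalues i ^ 2 := by
  have hU : star (hA.eigenvectorUnitary : Matrix ι ι ℂ) * (hA.eigenvectorUnitary : Matrix ι ι ℂ)
      = 1 := by simp
  conv_lhs => rw [hA.spectral_theorem, Unitary.conjStarAlgAut_apply]
  set Q := (hA.eigenvectorUnitary : Matrix ι ι ℂ)
  set D : Matrix ι ι ℂ := Matrix.diagonal (RCLike.ofReal ∘ hA.eigenvalues) with hD
  have e : Q * D * star Q * (Q * D * star Q) = Q * (D * D * star Q) := by
    calc _ = Q * D * (star Q * Q) * D * star Q := by noncomm_ring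
      _ = _ := by rw [hU]; noncomm_ring
  rw [e, rtr_mul_comm, mul_assoc, hU, mul_one, hD, Matrix.diagonal_mul_diagonal, rtr,
    Matrix.trace_diagonal]
  simp [sq]

/-- A positive semidefinite matrix is at most its trace times the identity. -/
lemma rtr_smul_one_sub_posSemidef {A : Matrix ι ι ℂ} (hA : A.PosSemidef) :
    (rtr A • (1 : Matrix ι ι ℂ) - A).PosSemidef := by
  refine smul_one_sub_posSemidef_of_eigenvalues hA.1 fun i => ?_
  rw [rtr_eq_sum_eigenvalues hA.1]
  exact Finset.single_le_sum (fun j _ => hA.eigenvalues_nonneg j) (Finset.mem_univ i)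

/-- A Hermitian matrix is at most its Frobenius norm times the identity. -/
lemma sqrt_frobSq_smul_one_sub_posSemidef {A : Matrix ι ι ℂ} (hA : A.IsHermitian) :
    (√(frobSq A) • (1 : Matrix ι ι ℂ) - A).PosSemidef := by
  refine smul_one_sub_posSemidef_of_eigenvalues hA fun i => Real.le_sqrt_of_sq_le ?_
  rw [frobSq_of_isHermitian hA, rtr_sq_eq_sum_eigenvalues hA]
  exact Finset.single_le_sum (f := fun j => hA.eigenvalues j ^ 2)
    (fun j _ => sq_nonneg _) (Finset.mem_univ i)

lemma rtr_mul_le_mul_rtr {A B : Matrix ι ι ℂ} (hA : A.PosSemidef) (hB : B.PosSemidef) :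
    rtr (A * B) ≤ rtr A * rtr B := by
  have := rtr_mul_le_of_sub (rtr_smul_one_sub_posSemidef hA) hB
  rwa [smul_mul_assoc, one_mul, rtr_smul] at this

/-- Loewner antitonicity of the inverse. -/
lemma inv_sub_inv_posSemidef {A B : Matrix ι ι ℂ} (hB : B.PosDef) (h : (A - B).PosSemidef) :
    (B⁻¹ - A⁻¹).PosSemidef := by
  have hA : A.PosDef := by simpa using hB.add_posSemidef h
  have uA := hA.isUnit
  have uB := hB.isUnit
  rw [Matrix.isUnit_iff_isUnit_det] at uA uB
  have e1 : (A⁻¹ * (A - B) * A⁻¹) = A⁻¹ - A⁻¹ * B * A⁻¹ := by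
    rw [mul_sub, sub_mul, Matrix.nonsing_inv_mul _ uA, one_mul]
  have e2 : A⁻¹ * (A - B) * B⁻¹ * ((A - B) * A⁻¹) =
      B⁻¹ - A⁻¹ - (A⁻¹ - A⁻¹ * B * A⁻¹) := by
    have : A⁻¹ * (A - B) * B⁻¹ = B⁻¹ - A⁻¹ := by
      rw [mul_sub, sub_mul, Matrix.nonsing_inv_mul _ uA, one_mul,
        Matrix.mul_nonsing_inv_cancel_right _ _ uB]
    rw [this, sub_mul A B, Matrix.mul_nonsing_inv _ uA, mul_sub, mul_one, sub_mul B⁻¹,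
      ← mul_assoc B⁻¹, Matrix.nonsing_inv_mul _ uB, one_mul, ← mul_assoc A⁻¹]
  have h1 : (A⁻¹ * (A - B) * A⁻¹).PosSemidef := conj_posSemidef h hA.inv.1
  have h2 : (A⁻¹ * (A - B) * B⁻¹ * ((A - B) * A⁻¹)).PosSemidef := by
    have := hB.inv.posSemidef.conjTranspose_mul_mul_same ((A - B) * A⁻¹)
    rwa [Matrix.conjTranspose_mul, hA.inv.1.eq, h.1.eq] at this
  have := h1.add h2
  rw [e2, e1] at this
  simpa using this

/-- The real logarithm of the determinant. -/
def logDet (A : Matrix ι ι ℂ) : ℝ := Real.log A.det.re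

lemma det_re_pos {A : Matrix ι ι ℂ} (hA : A.PosDef) : 0 < A.det.re :=
  (Complex.lt_def.1 hA.det_pos).1

lemma det_eq_re {A : Matrix ι ι ℂ} (hA : A.PosDef) : A.det = (A.det.re : ℂ) := by
  apply Complex.ext
  · simp
  · simpa using (Complex.lt_def.1 hA.det_pos).2.symm

lemma logDet_eq_sum {A : Matrix ι ι ℂ} (hA : A.PosDef) :
    logDet A = ∑ i, Real.log (hA.1.eigenvalues i) := by
  have : A.det.re = ∏ i, hA.1.eigenvalues i := by
    rw [hA.1.det_eq_prod_eigenvalues, ← Complex.ofReal_re (∏ i, hA.1.eigenvalues i)]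
    simp
  rw [logDet, this, Real.log_prod]
  intro i _
  exact (hA.eigenvalues_pos i).ne'

lemma logDet_one : logDet (1 : Matrix ι ι ℂ) = 0 := by simp [logDet]

lemma logDet_smul {A : Matrix ι ι ℂ} (hA : A.PosDef) {c : ℝ} (hc : 0 < c) :
    logDet (c • A) = Fintype.card ι * Real.log c + logDet A := by
  have : (c • A).det.re = c ^ Fintype.card ι * A.det.re := by
    have e : (c • A) = ((c : ℂ) • A) := by ext i j; simp
    rw [e, Matrix.det_smul, ← Complex.ofReal_pow, Complex.re_ofReal_mul]
  rw [logDet, this, Real.log_mul (by positivity) (det_re_pos hA).ne', Real.log_pow, logDet]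

/-- With `x = 1 + z`: `log (1 + z) ≤ z - z² / (2 (1 + ρ))` for `|z| ≤ ρ`. -/
lemma log_le_sub_sq {x ρ : ℝ} (hx : 0 < x) (h : |x - 1| ≤ ρ) :
    (x - 1) ^ 2 / (2 * (1 + ρ)) ≤ x - 1 - Real.log x := by
  have hρ : 0 ≤ ρ := (abs_nonneg _).trans h
  rcases le_total 1 x with h1 | h1
  · have hle : x ≤ 1 + ρ := by rw [abs_of_nonneg (by linarith)] at h; linarith
    have h2 : Real.log x ≤ (x - x⁻¹) / 2 := by
      have h3 := Real.self_le_sinh_iff.2 (Real.log_nonneg h1)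
      rwa [Real.sinh_eq, Real.exp_neg, Real.exp_log hx] at h3
    calc (x - 1) ^ 2 / (2 * (1 + ρ)) ≤ (x - 1) ^ 2 / (2 * x) := by gcongr
      _ = x - 1 - (x - x⁻¹) / 2 := by field_simp; ring
      _ ≤ _ := by linarith
  · have h2 : Real.log x ≤ x - 1 - (x - 1) ^ 2 / 2 := by
      have hc : MonotoneOn (fun y : ℝ => Real.log y - (y - 1) + (y - 1) ^ 2 / 2) (Set.Ioi 0) := by
        refine monotoneOn_of_deriv_nonneg (convex_Ioi 0) ?_ ?_ ?_
        · intro y hy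
          have hy' : y ≠ 0 := ne_of_gt hy
          exact (by fun_prop (disch := assumption) : ContinuousAt _ y).continuousWithinAt
        · intro y hy
          rw [interior_Ioi] at hy
          have hy' : y ≠ 0 := ne_of_gt hy
          exact (by fun_prop (disch := assumption) : DifferentiableAt ℝ _ y).differentiableWithinAt
        · intro y hy
          rw [interior_Ioi] at hy
          have hy0 : 0 < y := hy
          have hd : HasDerivAt (fun y : ℝ => Real.log y - (y - 1) + (y - 1) ^ 2 / 2)
              (y⁻¹ - 1 + (2 * (y - 1)) / 2) y := by
            have h1 := (Real.hasDerivAt_log hy0.ne').sub ((hasDerivAt_id y).sub_const 1)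
            have h2 := (((hasDerivAt_id y).sub_const 1).pow 2).div_const 2
            have h3 := h1.add h2
            simp only [id, Nat.cast_ofNat, mul_one, Nat.add_one_sub_one, pow_one] at h3
            exact h3
          rw [hd.deriv]
          have : y⁻¹ - 1 + (2 * (y - 1)) / 2 = (y - 1) ^ 2 / y := by field_simp; ring
          rw [this]
          positivity
      have := hc (Set.mem_Ioi.2 hx) (Set.mem_Ioi.2 one_pos) h1
      simp at this
      linarith
    have : (x - 1) ^ 2 / (2 * (1 + ρ)) ≤ (x - 1) ^ 2 / 2 := by
      apply div_le_div_of_nonneg_left (sq_nonneg _) (by norm_num); linarith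
    linarith

/-- The log-det divergence of a positive definite matrix from the identity dominates the squared
Frobenius distance. -/
lemma logDet_add_frobSq_le {H : Matrix ι ι ℂ} (hH : H.PosDef) :
    frobSq (H - 1) / (2 * (1 + √(frobSq (H - 1)))) ≤ rtr H - Fintype.card ι - logDet H := by
  have hf : frobSq (H - 1) = ∑ i, (hH.1.eigenvalues i - 1) ^ 2 := by
    rw [frobSq_of_isHermitian (hH.1.sub Matrix.isHermitian_one)]
    have : (H - 1) * (H - 1) = H * H - (2 : ℝ) • H + 1 := by
      rw [two_smul]; noncomm_ring
    rw [this, rtr_add, rtr_sub, rtr_smul, rtr_one, rtr_sq_eq_sum_eigenvalues hH.1,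
      rtr_eq_sum_eigenvalues hH.1]
    simp [sub_sq, Finset.sum_add_distrib, Finset.sum_sub_distrib, ← Finset.mul_sum]
  have hle : ∀ i, |hH.1.eigenvalues i - 1| ≤ √(frobSq (H - 1)) := by
    intro i
    apply Real.abs_le_sqrt
    rw [hf]
    exact Finset.single_le_sum (f := fun j => (hH.1.eigenvalues j - 1) ^ 2)
      (fun j _ => sq_nonneg _) (Finset.mem_univ i)
  rw [rtr_eq_sum_eigenvalues hH.1, logDet_eq_sum hH]
  have := Finset.sum_le_sum fun i (_ : i ∈ Finset.univ) =>
    log_le_sub_sq (hH.eigenvalues_pos i) (hle i)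
  rw [← Finset.sum_div, ← hf] at this
  refine this.trans (le_of_eq ?_)
  simp [Finset.sum_sub_distrib]

lemma logDet_le {H : Matrix ι ι ℂ} (hH : H.PosDef) : logDet H ≤ rtr H - Fintype.card ι := by
  have h1 := logDet_add_frobSq_le hH
  have h2 : 0 ≤ frobSq (H - 1) / (2 * (1 + √(frobSq (H - 1)))) :=
    div_nonneg (frobSq_nonneg _) (by positivity)
  linarith

/-- The arithmetic–geometric mean inequality for the eigenvalues. -/
lemma logDet_le_card_mul_log [Nonempty ι] {H : Matrix ι ι ℂ} (hH : H.PosDef) :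
    logDet H ≤ Fintype.card ι * Real.log (rtr H / Fintype.card ι) := by
  have hn : (0 : ℝ) < Fintype.card ι := by exact_mod_cast Fintype.card_pos
  have ht : 0 < rtr H := (Complex.lt_def.1 hH.trace_pos).1
  set c := rtr H / Fintype.card ι with hc
  have hc0 : 0 < c := by positivity
  have hH' : (c⁻¹ • H).PosDef := hH.smul (inv_pos.2 hc0)
  have h1 := logDet_le hH'
  rw [logDet_smul hH (inv_pos.2 hc0), rtr_smul, Real.log_inv] at h1
  have h2 : c⁻¹ * rtr H = Fintype.card ι := by rw [hc]; field_simp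
  linarith

lemma exists_posDef_sq {A : Matrix ι ι ℂ} (hA : A.PosDef) :
    ∃ S : Matrix ι ι ℂ, S.PosDef ∧ S * S = A := by
  obtain ⟨S, hS, rfl⟩ := exists_posSemidef_sq hA.posSemidef
  refine ⟨S, ?_, rfl⟩
  have h : IsUnit S := by
    have := hA.isUnit
    rw [Matrix.isUnit_iff_isUnit_det, Matrix.det_mul] at this
    rw [Matrix.isUnit_iff_isUnit_det]
    exact isUnit_of_mul_isUnit_left this
  exact hS.posDef_iff_isUnit.2 h

lemma conj_posDef {A S : Matrix ι ι ℂ} (hA : A.PosDef) (hS : S.PosDef) : (S * A * S).PosDef := by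
  have := hA.conjTranspose_mul_mul_same (B := S) (Matrix.mulVec_injective_of_isUnit hS.isUnit)
  rwa [hS.1.eq] at this

lemma logDet_mul {A B : Matrix ι ι ℂ} (hA : A.PosDef) (hB : B.PosDef) :
    logDet (A * B) = logDet A + logDet B := by
  have : (A * B).det.re = A.det.re * B.det.re := by
    rw [Matrix.det_mul, det_eq_re hA, Complex.re_ofReal_mul, Complex.ofReal_re]
  rw [logDet, this, Real.log_mul (det_re_pos hA).ne' (det_re_pos hB).ne', logDet, logDet]

lemma logDet_inv {A : Matrix ι ι ℂ} (hA : A.PosDef) : logDet A⁻¹ = -logDet A := by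
  have h := logDet_mul hA.inv hA
  have u := hA.isUnit
  rw [Matrix.isUnit_iff_isUnit_det] at u
  rw [Matrix.nonsing_inv_mul _ u, logDet_one] at h
  linarith

lemma logDet_conj {A S : Matrix ι ι ℂ} (hA : A.PosDef) (hS : S.PosDef) :
    logDet (S * A * S) = 2 * logDet S + logDet A := by
  have h : S.det.re * A.det.re * S.det.re = (S * A * S).det.re := by
    rw [Matrix.det_mul, Matrix.det_mul, det_eq_re hA, det_eq_re hS]
    simp [← Complex.ofReal_mul]
  have h1 := (det_re_pos hA).ne'
  have h2 := (det_re_pos hS).ne'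
  rw [logDet, ← h, Real.log_mul (mul_ne_zero h2 h1) h2, Real.log_mul h2 h1, logDet, logDet]
  ring

/-- The squared norm of `D` in the metric of the log-det barrier at `Y`. -/
def localSq (Y D : Matrix ι ι ℂ) : ℝ := rtr (Y⁻¹ * D * Y⁻¹ * D)

lemma localSq_eq_frobSq {S D : Matrix ι ι ℂ} (hS : S.PosDef) (hD : D.IsHermitian) :
    localSq (S * S) D = frobSq (S⁻¹ * D * S⁻¹) := by
  have h : (S⁻¹ * D * S⁻¹).IsHermitian := by
    have := Matrix.isHermitian_conjTranspose_mul_mul S⁻¹ hD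
    rwa [hS.inv.1.eq] at this
  rw [frobSq_of_isHermitian h, localSq, Matrix.mul_inv_rev]
  calc rtr (S⁻¹ * S⁻¹ * D * (S⁻¹ * S⁻¹) * D)
      = rtr (S⁻¹ * (S⁻¹ * D * (S⁻¹ * S⁻¹) * D)) := by noncomm_ring
    _ = rtr (S⁻¹ * D * (S⁻¹ * S⁻¹) * D * S⁻¹) := rtr_mul_comm _ _
    _ = _ := by noncomm_ring

lemma localSq_nonneg {Y D : Matrix ι ι ℂ} (hY : Y.PosDef) (hD : D.IsHermitian) :
    0 ≤ localSq Y D := by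
  obtain ⟨S, hS, rfl⟩ := exists_posDef_sq hY
  rw [localSq_eq_frobSq hS hD]
  exact frobSq_nonneg _

/-- Quantitative concavity of the log-determinant: conjugation by the inverse square root of `Y`
reduces it to the divergence from the identity. -/
lemma logDet_sub_add_localSq_le {Y Z : Matrix ι ι ℂ} (hY : Y.PosDef) (hZ : Z.PosDef) :
    localSq Y (Z - Y) / (2 * (1 + √(localSq Y (Z - Y)))) ≤
      rtr (Y⁻¹ * (Z - Y)) - (logDet Z - logDet Y) := by
  obtain ⟨S, hS, rfl⟩ := exists_posDef_sq hY
  have u := hS.isUnit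
  rw [Matrix.isUnit_iff_isUnit_det] at u
  rw [localSq_eq_frobSq hS (hZ.1.sub hY.1)]
  have hH := conj_posDef hZ hS.inv
  have e : S⁻¹ * (Z - S * S) * S⁻¹ = S⁻¹ * Z * S⁻¹ - 1 := by
    rw [mul_sub, sub_mul, Matrix.nonsing_inv_mul_cancel_left _ _ u, Matrix.mul_nonsing_inv _ u]
  have h := logDet_add_frobSq_le hH
  rw [logDet_conj hZ hS.inv, logDet_inv hS] at h
  rw [e, logDet_mul hS hS]
  have e2 : rtr ((S * S)⁻¹ * (Z - S * S)) = rtr (S⁻¹ * Z * S⁻¹) - Fintype.card ι := by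
    have uu : IsUnit (S * S).det := by rw [Matrix.det_mul]; exact u.mul u
    rw [mul_sub, Matrix.nonsing_inv_mul _ uu, rtr_sub, rtr_one, Matrix.mul_inv_rev, mul_assoc,
      rtr_mul_comm (S⁻¹)]
  rw [e2]
  linarith

/-- Concavity of the log-determinant. -/
lemma logDet_sub_le {Y Z : Matrix ι ι ℂ} (hY : Y.PosDef) (hZ : Z.PosDef) :
    logDet Z - logDet Y ≤ rtr (Y⁻¹ * (Z - Y)) := by
  have h := logDet_sub_add_localSq_le hY hZ
  have h2 : 0 ≤ localSq Y (Z - Y) / (2 * (1 + √(localSq Y (Z - Y)))) :=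
    div_nonneg (localSq_nonneg hY (hZ.1.sub hY.1)) (by positivity)
  linarith

end Matrices

/-! ### The elliptic potential of the online Newton step -/

section Potential

variable {ι : Type*} [Fintype ι]

lemma rtr_mul_vecMulVec (A : Matrix ι ι ℂ) (v : ι → ℂ) :
    rtr (A * Matrix.vecMulVec v (star v)) = (star v ⬝ᵥ A *ᵥ v).re := by
  rw [Matrix.mul_vecMulVec, rtr, Matrix.trace_vecMulVec, dotProduct_comm]

variable [DecidableEq ι]

lemma neg_re_dotProduct_sub_le {A : Matrix ι ι ℂ} (hA : A.PosDef) (x v : ι → ℂ) :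
    -(star x ⬝ᵥ v).re - (star x ⬝ᵥ A *ᵥ x).re / 2 ≤ (star v ⬝ᵥ A⁻¹ *ᵥ v).re / 2 := by
  have u := hA.isUnit
  rw [Matrix.isUnit_iff_isUnit_det] at u
  have h := hA.posSemidef.re_dotProduct_nonneg (x + A⁻¹ *ᵥ v)
  have e1 : A *ᵥ (x + A⁻¹ *ᵥ v) = A *ᵥ x + v := by
    rw [Matrix.mulVec_add, Matrix.mulVec_mulVec, Matrix.mul_nonsing_inv _ u, Matrix.one_mulVec]
  have e2 : star (A⁻¹ *ᵥ v) = star v ᵥ* A⁻¹ := by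
    rw [Matrix.star_mulVec, hA.inv.1.eq]
  have e3 : star v ᵥ* A⁻¹ ⬝ᵥ A *ᵥ x = star v ⬝ᵥ x := by
    rw [← Matrix.dotProduct_mulVec, Matrix.mulVec_mulVec, Matrix.nonsing_inv_mul _ u,
      Matrix.one_mulVec]
  have e4 : (star v ⬝ᵥ x).re = (star x ⬝ᵥ v).re := by
    have e5 : star v ⬝ᵥ x = star (star x ⬝ᵥ v) := by
      rw [← Matrix.star_dotProduct_star, star_star, dotProduct_comm]
    rw [e5, Complex.star_def, Complex.conj_re]
  rw [e1, star_add, e2, add_dotProduct, dotProduct_add, dotProduct_add, e3,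
    ← Matrix.dotProduct_mulVec] at h
  simp only [map_add, RCLike.re_to_complex, e4] at h
  linarith

/-- The regularized second-moment matrix `κ I + β ∑_{r < k} v_r v_r*`. -/
def secondMoment (κ β : ℝ) (v : ℕ → ι → ℂ) (k : ℕ) : Matrix ι ι ℂ :=
  κ • (1 : Matrix ι ι ℂ) + ∑ r ∈ Finset.range k, β • Matrix.vecMulVec (v r) (star (v r))

lemma secondMoment_posDef {κ β : ℝ} (hκ : 0 < κ) (hβ : 0 ≤ β) (v : ℕ → ι → ℂ) (k : ℕ) :
    (secondMoment κ β v k).PosDef :=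
  (Matrix.PosDef.one.smul hκ).add_posSemidef
    (Matrix.posSemidef_sum _ fun r _ => (Matrix.posSemidef_vecMulVec_self_star (v r)).smul hβ)

lemma secondMoment_quadratic (κ β : ℝ) (v : ℕ → ι → ℂ) (k : ℕ) (x : ι → ℂ) :
    (star x ⬝ᵥ secondMoment κ β v k *ᵥ x).re =
      κ * (star x ⬝ᵥ x).re + β * ∑ r ∈ Finset.range k, ‖star x ⬝ᵥ v r‖ ^ 2 := by
  have h1 : ∀ r, (star x ⬝ᵥ Matrix.vecMulVec (v r) (star (v r)) *ᵥ x).re =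
      ‖star x ⬝ᵥ v r‖ ^ 2 := by
    intro r
    have e : star (v r) ⬝ᵥ x = star (star x ⬝ᵥ v r) := by
      rw [← Matrix.star_dotProduct_star, star_star, dotProduct_comm]
    rw [Matrix.vecMulVec_mulVec, e]
    rw [dotProduct_smul, Complex.sq_norm, MulOpposite.smul_eq_mul_unop, MulOpposite.unop_op,
      Complex.star_def, Complex.mul_conj, Complex.ofReal_re]
  rw [secondMoment, Matrix.add_mulVec, dotProduct_add, Complex.add_re, Matrix.smul_mulVec,
    Matrix.one_mulVec, Matrix.sum_mulVec, dotProduct_sum, Complex.re_sum, Finset.mul_sum]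
  congr 1
  · simp
  · refine Finset.sum_congr rfl fun r _ => ?_
    rw [Matrix.smul_mulVec, dotProduct_smul, ← h1 r]
    simp

/-- The cumulative stability cost of the online Newton step is controlled by the growth of the
log-determinant of the second-moment matrix. -/
lemma online_newton_potential [Nonempty ι] {κ β : ℝ} (hκ : 0 < κ) (hβ : 0 < β)
    (v x : ℕ → ι → ℂ) (n : ℕ) :
    ∑ k ∈ Finset.range n, (-(star (x k) ⬝ᵥ v k).re - (κ * (star (x k) ⬝ᵥ x k).re +
        β * ∑ r ∈ Finset.range (k + 1), ‖star (x k) ⬝ᵥ v r‖ ^ 2) / 2) ≤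
      Fintype.card ι / (2 * β) * Real.log (1 + β / (κ * Fintype.card ι) *
        ∑ r ∈ Finset.range n, (star (v r) ⬝ᵥ v r).re) := by
  have hpd := secondMoment_posDef hκ hβ.le v
  have hN : (0 : ℝ) < Fintype.card ι := by exact_mod_cast Fintype.card_pos
  -- One step costs at most the increase of the log-determinant, by concavity.
  have step : ∀ k, -(star (x k) ⬝ᵥ v k).re - (κ * (star (x k) ⬝ᵥ x k).re +
        β * ∑ r ∈ Finset.range (k + 1), ‖star (x k) ⬝ᵥ v r‖ ^ 2) / 2 ≤
      (2 * β)⁻¹ * (logDet (secondMoment κ β v (k + 1)) - logDet (secondMoment κ β v k)) := by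
    intro k
    have h1 := neg_re_dotProduct_sub_le (hpd (k + 1)) (x k) (v k)
    rw [secondMoment_quadratic] at h1
    have h2 := logDet_sub_le (hpd (k + 1)) (hpd k)
    have e : secondMoment κ β v k - secondMoment κ β v (k + 1) =
        (-β) • Matrix.vecMulVec (v k) (star (v k)) := by
      rw [secondMoment, secondMoment, Finset.sum_range_succ, neg_smul]
      abel
    rw [e, mul_smul_comm, rtr_smul, rtr_mul_vecMulVec] at h2
    refine h1.trans ?_
    rw [inv_mul_eq_div, le_div_iff₀ (by positivity)]
    linarith
  refine (Finset.sum_le_sum fun k _ => step k).trans ?_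
  rw [← Finset.mul_sum, Finset.sum_range_sub (fun k => logDet (secondMoment κ β v k))]
  have h0 : logDet (secondMoment κ β v 0) = Fintype.card ι * Real.log κ := by
    simp [secondMoment, logDet_smul Matrix.PosDef.one hκ, logDet_one]
  have ht : rtr (secondMoment κ β v n) =
      κ * Fintype.card ι + β * ∑ r ∈ Finset.range n, (star (v r) ⬝ᵥ v r).re := by
    have hs : ∀ m, rtr (∑ r ∈ Finset.range m, β • Matrix.vecMulVec (v r) (star (v r))) =
        β * ∑ r ∈ Finset.range m, (star (v r) ⬝ᵥ v r).re := by
      intro m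
      induction m with
      | zero => simp [rtr]
      | succ m ih =>
        rw [Finset.sum_range_succ, rtr_add, ih, Finset.sum_range_succ, mul_add, rtr_smul]
        congr 2
        rw [rtr, Matrix.trace_vecMulVec, dotProduct_comm]
    rw [secondMoment, rtr_add, rtr_smul, rtr_one, hs]
  have hn := logDet_le_card_mul_log (hpd n)
  have hsum : 0 ≤ ∑ r ∈ Finset.range n, (star (v r) ⬝ᵥ v r).re :=
    Finset.sum_nonneg fun r _ => (Complex.le_def.1 (dotProduct_star_self_nonneg (v r))).1
  have he : rtr (secondMoment κ β v n) / Fintype.card ι = κ * (1 + β / (κ * Fintype.card ι) *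
        ∑ r ∈ Finset.range n, (star (v r) ⬝ᵥ v r).re) := by
    rw [ht]; field_simp
  rw [he, Real.log_mul hκ.ne' (by positivity)] at hn
  rw [h0, inv_mul_eq_div, div_mul_eq_mul_div]
  gcongr
  linarith

end Potential

/-! ### The bias update -/

section Bias

variable {d : ℕ}

lemma ip_eq_rtr {X : Mat d} (hX : X.IsHermitian) (Y : Mat d) : ip X Y = rtr (X * Y) := by
  rw [ip, rtr, hX.eq]

open scoped MatrixOrder in
lemma msqrt_posSemidef (X : Mat d) : (msqrt X).PosSemidef :=
  Matrix.nonneg_iff_posSemidef.1 (cfc_nonneg fun x _ => Real.sqrt_nonneg x)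

open scoped MatrixOrder in
lemma msqrt_mul_msqrt {X : Mat d} (hX : X.PosSemidef) : msqrt X * msqrt X = X := by
  rw [msqrt, ← cfc_mul _ _ X]
  have h : ∀ x ∈ spectrum ℝ X, √x * √x = x := fun x hx =>
    Real.mul_self_sqrt (spectrum_nonneg_of_nonneg (Matrix.nonneg_iff_posSemidef.2 hX) hx)
  rw [cfc_congr h, cfc_id' ℝ X hX.1.isSelfAdjoint]

lemma msqrt_posDef {X : Mat d} (hX : X.PosDef) : (msqrt X).PosDef := by
  refine (msqrt_posSemidef X).posDef_iff_isUnit.2 ?_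
  have := hX.isUnit
  rw [← msqrt_mul_msqrt hX.posSemidef, Matrix.isUnit_iff_isUnit_det, Matrix.det_mul] at this
  rw [Matrix.isUnit_iff_isUnit_det]
  exact isUnit_of_mul_isUnit_left this

open scoped MatrixOrder in
lemma mposPart_posSemidef (A : Mat d) : (mposPart A).PosSemidef :=
  Matrix.nonneg_iff_posSemidef.1 (cfc_nonneg fun _ _ => le_max_right _ _)

open scoped MatrixOrder in
lemma mposPart_sub_posSemidef {A : Mat d} (hA : A.IsHermitian) :
    (mposPart A - A).PosSemidef := by
  have h : mposPart A - A = cfc (fun x : ℝ => max x 0 - x) A := by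
    rw [cfc_sub (fun x : ℝ => max x 0) (fun x => x) A, cfc_id' ℝ A hA.isSelfAdjoint, mposPart]
  rw [h]
  exact Matrix.nonneg_iff_posSemidef.1 (cfc_nonneg fun x _ => sub_nonneg.2 (le_max_left _ _))

lemma mposPart_mul_self {A : Mat d} (hA : A.IsHermitian) :
    mposPart A * A = mposPart A * mposPart A := by
  have h1 : mposPart A * A = cfc (fun x : ℝ => max x 0 * x) A := by
    rw [cfc_mul (fun x : ℝ => max x 0) (fun x => x) A, cfc_id' ℝ A hA.isSelfAdjoint, mposPart]
  rw [h1, mposPart, ← cfc_mul (fun x : ℝ => max x 0) (fun x : ℝ => max x 0) A]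
  congr 1
  funext x
  rcases le_total x 0 with h | h
  · simp [max_eq_right h]
  · simp [max_eq_left h]

/-- The positive part `(I - X^{1/2} P X^{1/2})₊` that drives the bias update. -/
def biasGap (P X : Mat d) : Mat d := mposPart (1 - msqrt X * P * msqrt X)

lemma biasUpdate_eq (P X : Mat d) :
    biasUpdate P X = P + (msqrt X)⁻¹ * biasGap P X * (msqrt X)⁻¹ := rfl

lemma biasGap_posSemidef (P X : Mat d) : (biasGap P X).PosSemidef := mposPart_posSemidef _

lemma biasIncrement_posSemidef {P X : Mat d} (hX : X.PosDef) :
    (biasUpdate P X - P).PosSemidef := by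
  rw [biasUpdate_eq, add_sub_cancel_left]
  exact conj_posSemidef (biasGap_posSemidef P X) (msqrt_posDef hX).inv.1

lemma biasUpdate_posDef {P X : Mat d} (hP : P.PosDef) (hX : X.PosDef) :
    (biasUpdate P X).PosDef := by
  have := hP.add_posSemidef (biasIncrement_posSemidef (P := P) hX)
  rwa [add_sub_cancel] at this

lemma isUnit_det_msqrt {X : Mat d} (hX : X.PosDef) : IsUnit (msqrt X).det :=
  (Matrix.isUnit_iff_isUnit_det _).1 (msqrt_posDef hX).isUnit

lemma biasBase_isHermitian {P : Mat d} (hP : P.PosDef) (X : Mat d) :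
    (1 - msqrt X * P * msqrt X).IsHermitian :=
  Matrix.isHermitian_one.sub (conj_posSemidef hP.posSemidef (msqrt_posSemidef X).1).1

lemma inv_eq_msqrt_inv {X : Mat d} (hX : X.PosDef) : X⁻¹ = (msqrt X)⁻¹ * (msqrt X)⁻¹ := by
  rw [← Matrix.mul_inv_rev, msqrt_mul_msqrt hX.posSemidef]

/-- The updated bias dominates the inverse of the played state. -/
lemma biasUpdate_sub_inv_posSemidef {P X : Mat d} (hP : P.PosDef) (hX : X.PosDef) :
    (biasUpdate P X - X⁻¹).PosSemidef := by
  have u := isUnit_det_msqrt hX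
  have h := conj_posSemidef (mposPart_sub_posSemidef (biasBase_isHermitian hP X))
    (msqrt_posDef hX).inv.1
  have e : (msqrt X)⁻¹ * (mposPart (1 - msqrt X * P * msqrt X) - (1 - msqrt X * P * msqrt X)) *
      (msqrt X)⁻¹ = biasUpdate P X - X⁻¹ := by
    have e1 : (msqrt X)⁻¹ * (msqrt X * P * msqrt X) * (msqrt X)⁻¹ = P := by
      rw [mul_assoc (msqrt X), Matrix.nonsing_inv_mul_cancel_left _ _ u,
        Matrix.mul_nonsing_inv_cancel_right _ _ u]
    rw [mul_sub, sub_mul, mul_sub, sub_mul, e1, mul_one, biasUpdate_eq, biasGap,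
      inv_eq_msqrt_inv hX]
    abel
  rwa [e] at h

/-- The bias increment, paired with the played state, is the trace of the gap. -/
lemma ip_biasIncrement {P X : Mat d} (hX : X.PosDef) :
    ip X (biasUpdate P X - P) = rtr (biasGap P X) := by
  have u := isUnit_det_msqrt hX
  rw [ip_eq_rtr hX.1, biasUpdate_eq, add_sub_cancel_left]
  nth_rewrite 1 [← msqrt_mul_msqrt hX.posSemidef]
  rw [mul_assoc (msqrt X)⁻¹, mul_assoc (msqrt X), Matrix.mul_nonsing_inv_cancel_left _ _ u,
    rtr_mul_comm, mul_assoc, Matrix.nonsing_inv_mul _ u, mul_one]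

/-- The trace of the gap is paid for by the growth of the log-determinant of the bias. -/
lemma rtr_biasGap_le {P X : Mat d} (hP : P.PosDef) (hX : X.PosDef) :
    rtr (biasGap P X) ≤ logDet (biasUpdate P X) - logDet P := by
  have u := isUnit_det_msqrt hX
  have hP' := biasUpdate_posDef hP hX
  have uP := hP'.isUnit
  rw [Matrix.isUnit_iff_isUnit_det] at uP
  have h := logDet_sub_le hP' hP
  -- The gap lives on the eigenspaces where the update raises the eigenvalue to one.
  have hfix : (msqrt X * P * msqrt X + biasGap P X) * biasGap P X = biasGap P X := by
    have h1 := mposPart_mul_self (biasBase_isHermitian hP X)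
    have h2 : biasGap P X * (msqrt X * P * msqrt X + biasGap P X) = biasGap P X := by
      rw [mul_add, biasGap, ← h1, mul_sub, mul_one]
      abel
    have h3 := congrArg Matrix.conjTranspose h2
    rwa [Matrix.conjTranspose_mul, Matrix.conjTranspose_add, (biasGap_posSemidef P X).1.eq,
      (conj_posSemidef hP.posSemidef (msqrt_posSemidef X).1).1.eq] at h3
  have h4 : biasUpdate P X * (msqrt X * biasGap P X) = (msqrt X)⁻¹ * biasGap P X := by
    nth_rewrite 2 [← hfix]
    rw [biasUpdate_eq, add_mul, add_mul, mul_add]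
    congr 1
    · rw [mul_assoc (msqrt X), mul_assoc (msqrt X), Matrix.nonsing_inv_mul_cancel_left _ _ u,
        mul_assoc]
    · rw [mul_assoc, Matrix.nonsing_inv_mul_cancel_left _ _ u, mul_assoc]
  have h5 : (biasUpdate P X)⁻¹ * ((msqrt X)⁻¹ * biasGap P X) = msqrt X * biasGap P X := by
    rw [← h4, Matrix.nonsing_inv_mul_cancel_left _ _ uP]
  have h6 : rtr ((biasUpdate P X)⁻¹ * (P - biasUpdate P X)) = -rtr (biasGap P X) := by
    have e : P - biasUpdate P X = (-1 : ℝ) • ((msqrt X)⁻¹ * biasGap P X * (msqrt X)⁻¹) := by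
      rw [biasUpdate_eq, neg_one_smul]; abel
    rw [e, mul_smul_comm, rtr_smul, ← mul_assoc, h5, rtr_mul_comm,
      Matrix.nonsing_inv_mul_cancel_left _ _ u]
    ring
  linarith

/-- If the bias dominates `Y⁻¹`, then the Frobenius norm of the gap at `X` is at most the local
distance between `X` and `Y`. -/
lemma frobSq_biasGap_le {P X Y : Mat d} (hP : P.PosDef) (hX : X.PosDef) (hY : Y.PosDef)
    (h : (P - Y⁻¹).PosSemidef) : frobSq (biasGap P X) ≤ localSq Y (X - Y) := by
  have hS := msqrt_posDef hX
  have uY := hY.isUnit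
  rw [Matrix.isUnit_iff_isUnit_det] at uY
  have hM := biasGap_posSemidef P X
  have hV : (1 - msqrt X * Y⁻¹ * msqrt X).IsHermitian := biasBase_isHermitian hY.inv X
  -- `A₊² = A₊ A`, and `A` increases when `P` is replaced by the smaller matrix `Y⁻¹`.
  have h1 : frobSq (biasGap P X) ≤ rtr ((1 - msqrt X * Y⁻¹ * msqrt X) * biasGap P X) := by
    rw [frobSq_of_isHermitian hM.1, biasGap, ← mposPart_mul_self (biasBase_isHermitian hP X),
      rtr_mul_comm]
    refine rtr_mul_le_of_sub ?_ hM
    have := conj_posSemidef h hS.1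
    have e : msqrt X * (P - Y⁻¹) * msqrt X =
        1 - msqrt X * Y⁻¹ * msqrt X - (1 - msqrt X * P * msqrt X) := by
      noncomm_ring
    rwa [e] at this
  have h2 := rtr_mul_sq_le hV hM.1
  have h3 : frobSq (1 - msqrt X * Y⁻¹ * msqrt X) = localSq Y (X - Y) := by
    rw [frobSq_of_isHermitian hV, localSq]
    have e1 : (1 - msqrt X * Y⁻¹ * msqrt X) * (1 - msqrt X * Y⁻¹ * msqrt X) =
        1 - (2 : ℝ) • (msqrt X * (Y⁻¹ * msqrt X)) +
          msqrt X * (Y⁻¹ * (msqrt X * msqrt X) * Y⁻¹ * msqrt X) := by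
      rw [two_smul]; noncomm_ring
    have e2 : Y⁻¹ * (X - Y) * Y⁻¹ * (X - Y) =
        1 - (2 : ℝ) • (Y⁻¹ * X) + Y⁻¹ * X * Y⁻¹ * X := by
      have e0 : Y⁻¹ * (X - Y) = Y⁻¹ * X - 1 := by rw [mul_sub, Matrix.nonsing_inv_mul _ uY]
      rw [mul_assoc _ Y⁻¹, e0, two_smul]
      noncomm_ring
    rw [e1, e2, msqrt_mul_msqrt hX.posSemidef]
    simp only [rtr_add, rtr_sub, rtr_smul]
    rw [rtr_mul_comm (msqrt X), rtr_mul_comm (msqrt X), mul_assoc, mul_assoc _ _ (msqrt X),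
      msqrt_mul_msqrt hX.posSemidef]
  rw [h3] at h2
  have h4 := frobSq_nonneg (biasGap P X)
  have h5 : frobSq (biasGap P X) ^ 2 ≤ localSq Y (X - Y) * frobSq (biasGap P X) :=
    (pow_le_pow_left₀ h4 h1 2).trans h2
  rcases h4.eq_or_lt with h6 | h6
  · rw [← h6]
    exact localSq_nonneg hY (hX.1.sub hY.1)
  · nlinarith

/-- A small gap means that the bias grows by a factor close to one. -/
lemma sub_smul_biasUpdate_posSemidef {P X : Mat d} (hP : P.PosDef) (hX : X.PosDef) {ε : ℝ}
    (hε : 0 ≤ ε) (h : √(frobSq (biasGap P X)) ≤ ε) :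
    (P - (1 - ε) • biasUpdate P X).PosSemidef := by
  have hS := msqrt_posDef hX
  have h1 : (ε • (1 : Mat d) - biasGap P X).PosSemidef := by
    have h2 := sqrt_frobSq_smul_one_sub_posSemidef (biasGap_posSemidef P X).1
    have h3 := (Matrix.PosSemidef.one (n := Fin d) (R := ℂ)).smul (sub_nonneg.2 h)
    have := h3.add h2
    rwa [sub_smul, sub_add_sub_cancel] at this
  have h2 := ((biasUpdate_sub_inv_posSemidef hP hX).smul hε).add (conj_posSemidef h1 hS.inv.1)
  have e : ε • (biasUpdate P X - X⁻¹) + (msqrt X)⁻¹ * (ε • (1 : Mat d) - biasGap P X) *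
      (msqrt X)⁻¹ = P - (1 - ε) • biasUpdate P X := by
    rw [mul_sub, sub_mul, mul_smul_comm, smul_mul_assoc, mul_one, ← inv_eq_msqrt_inv hX, smul_sub,
      sub_smul, one_smul]
    have e1 : (msqrt X)⁻¹ * biasGap P X * (msqrt X)⁻¹ = biasUpdate P X - P := by
      rw [biasUpdate_eq, add_sub_cancel_left]
    rw [e1]
    abel
  rwa [e] at h2

lemma abs_ip_biasIncrement_le {P X D : Mat d} (hX : X.PosDef) (hD : D.IsHermitian) :
    |ip D (biasUpdate P X - P)| ≤ √(localSq X D) * √(frobSq (biasGap P X)) := by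
  have hS := msqrt_posDef hX
  have h : localSq X D = frobSq ((msqrt X)⁻¹ * D * (msqrt X)⁻¹) := by
    rw [← localSq_eq_frobSq hS hD, msqrt_mul_msqrt hX.posSemidef]
  have hH : ((msqrt X)⁻¹ * D * (msqrt X)⁻¹).IsHermitian := by
    have := Matrix.isHermitian_conjTranspose_mul_mul (msqrt X)⁻¹ hD
    rwa [hS.inv.1.eq] at this
  have e : ip D (biasUpdate P X - P) = rtr ((msqrt X)⁻¹ * D * (msqrt X)⁻¹ * biasGap P X) := by
    rw [ip_eq_rtr hD, biasUpdate_eq, add_sub_cancel_left, ← mul_assoc, rtr_mul_comm]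
    congr 1
    noncomm_ring
  rw [h, e]
  exact abs_rtr_mul_le hH (biasGap_posSemidef P X).1

end Bias

/-! ### Quantum states and minimizers of barrier-regularized objectives -/

section States

variable {d : ℕ}

lemma rtr_of_mem_states {X : Mat d} (hX : X ∈ states d) : rtr X = 1 := by
  rw [rtr, hX.2, Complex.one_re]

lemma frobSq_le_one {X : Mat d} (hX : X ∈ states d) : frobSq X ≤ 1 := by
  rw [frobSq_of_isHermitian hX.1.1]
  have := rtr_mul_le_mul_rtr hX.1 hX.1
  rwa [rtr_of_mem_states hX, one_mul] at this

lemma one_sub_posSemidef_of_mem_states {X : Mat d} (hX : X ∈ states d) : (1 - X).PosSemidef := by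
  have := rtr_smul_one_sub_posSemidef hX.1
  rwa [rtr_of_mem_states hX, one_smul] at this

lemma convex_states (d : ℕ) : Convex ℝ (states d) := by
  intro X hX Y hY a b ha hb hab
  refine ⟨(hX.1.smul ha).add (hY.1.smul hb), ?_⟩
  rw [Matrix.trace_add, Matrix.trace_smul, Matrix.trace_smul, hX.2, hY.2, ← add_smul, hab,
    one_smul]

lemma isClosed_states (d : ℕ) : IsClosed (states d) := by
  have h : states d = {X | Xᴴ = X} ∩
      (⋂ x : Fin d → ℂ, {X | 0 ≤ star x ⬝ᵥ X *ᵥ x}) ∩ {X | X.trace = 1} := by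
    ext X
    simp [states, Matrix.posSemidef_iff_dotProduct_mulVec, Matrix.IsHermitian]
  rw [h]
  refine ((isClosed_eq (by fun_prop) continuous_id).inter (isClosed_iInter fun x => ?_)).inter
    (isClosed_eq (by fun_prop) continuous_const)
  exact isClosed_le continuous_const (by fun_prop)

lemma isCompact_states (d : ℕ) : IsCompact (states d) := by
  refine IsCompact.of_isClosed_subset (isCompact_univ_pi fun _ : Fin d =>
    isCompact_univ_pi fun _ : Fin d => isCompact_closedBall (0 : ℂ) 1) (isClosed_states d) ?_
  intro X hX i _ j _
  rw [mem_closedBall_zero_iff]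
  have := (norm_sq_le_frobSq X i j).trans (frobSq_le_one hX)
  exact (sq_le_one_iff₀ (norm_nonneg _)).1 this

/-- The maximally mixed state `I / d`. -/
def mixedState (d : ℕ) : Mat d := (d : ℝ)⁻¹ • (1 : Mat d)

lemma mixedState_posDef (hd : 1 ≤ d) : (mixedState d).PosDef :=
  Matrix.PosDef.one.smul (inv_pos.2 (by exact_mod_cast hd))

lemma mixedState_mem (hd : 1 ≤ d) : mixedState d ∈ states d := by
  refine ⟨(mixedState_posDef hd).posSemidef, ?_⟩
  have : (d : ℂ) ≠ 0 := by exact_mod_cast (by lia : d ≠ 0)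
  simp [mixedState, Matrix.trace_smul, this]

lemma logDet_mixedState (hd : 1 ≤ d) : logDet (mixedState d) = -(d * Real.log d) := by
  have h : (0 : ℝ) < d := by exact_mod_cast hd
  rw [mixedState, logDet_smul Matrix.PosDef.one (inv_pos.2 h), logDet_one, Real.log_inv]
  simp

/-- On states, the barrier metric dominates the Frobenius metric. -/
lemma frobSq_le_localSq {Y D : Mat d} (hY : Y ∈ states d) (hpd : Y.PosDef)
    (hD : D.IsHermitian) : frobSq D ≤ localSq Y D := by
  have h1 : (Y⁻¹ - 1).PosSemidef := by
    have := inv_sub_inv_posSemidef hpd (one_sub_posSemidef_of_mem_states hY)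
    rwa [inv_one] at this
  have h2 := rtr_mul_le_of_sub h1 (conj_posSemidef hpd.inv.posSemidef hD)
  have h3 := rtr_mul_le_of_sub h1 (Matrix.posSemidef_conjTranspose_mul_self D)
  rw [hD.eq] at h3
  rw [one_mul] at h2 h3
  rw [frobSq_of_isHermitian hD, localSq]
  have e1 : rtr (Y⁻¹ * D * Y⁻¹ * D) = rtr (Y⁻¹ * (D * Y⁻¹ * D)) := by
    congr 1; noncomm_ring
  have e2 : rtr (D * Y⁻¹ * D) = rtr (Y⁻¹ * (D * D)) := by
    rw [mul_assoc, rtr_mul_comm, mul_assoc]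
  linarith

lemma logDetBarrier_of_posDef {X : Mat d} (hX : X.PosDef) :
    logDetBarrier X = ((-logDet X : ℝ) : EReal) :=
  negLog_of_pos (det_re_pos hX)

lemma continuous_logDetBarrier : Continuous (logDetBarrier (d := d)) := by
  have h : Continuous fun X : Mat d => X.det.re :=
    Complex.continuous_re.comp (Continuous.matrix_det continuous_id)
  exact continuous_neg.comp (ENNReal.continuous_log.comp (ENNReal.continuous_ofReal.comp h))

/-- The objective `η⁻¹ R + q`, where `R` is the log-det barrier. -/
def barrierObjective (η : ℝ) (q : Mat d → ℝ) : Mat d → EReal :=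
  fun X => ((η⁻¹ : ℝ) : EReal) * logDetBarrier X + (q X : EReal)

lemma barrierObjective_of_posDef (η : ℝ) (q : Mat d → ℝ) {X : Mat d} (hX : X.PosDef) :
    barrierObjective η q X = ((q X - η⁻¹ * logDet X : ℝ) : EReal) := by
  rw [barrierObjective, logDetBarrier_of_posDef hX, ← EReal.coe_mul, ← EReal.coe_add]
  congr 1
  ring

/-- `X` is a positive definite state that minimizes `q - η⁻¹ log det` among such states. -/
structure IsBarrierMin (η : ℝ) (q : Mat d → ℝ) (X : Mat d) : Prop where
  mem : X ∈ states d
  posDef : X.PosDef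
  le : ∀ Z ∈ states d, Z.PosDef → q X - η⁻¹ * logDet X ≤ q Z - η⁻¹ * logDet Z

lemma isBarrierMin_argminStates (hd : 1 ≤ d) {η : ℝ} (hη : 0 < η) {q : Mat d → ℝ}
    (hq : Continuous q) : IsBarrierMin η q (argminStates (barrierObjective η q)) := by
  have hη' : 0 < η⁻¹ := inv_pos.2 hη
  have hne0 : ((η⁻¹ : ℝ) : EReal) ≠ 0 := by exact_mod_cast hη'.ne'
  have hmul : Continuous fun X : Mat d => ((η⁻¹ : ℝ) : EReal) * logDetBarrier X := by
    refine continuous_iff_continuousAt.2 fun X => ?_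
    exact ContinuousAt.comp (f := fun X : Mat d => (((η⁻¹ : ℝ) : EReal), logDetBarrier X))
      (EReal.continuousAt_mul (Or.inl hne0) (Or.inl hne0) (Or.inl (EReal.coe_ne_bot _))
        (Or.inl (EReal.coe_ne_top _)))
      (continuousAt_const.prodMk continuous_logDetBarrier.continuousAt)
  have hcont : Continuous (barrierObjective η q) := by
    refine continuous_iff_continuousAt.2 fun X => ?_
    exact ContinuousAt.comp
      (f := fun X : Mat d => (((η⁻¹ : ℝ) : EReal) * logDetBarrier X, (q X : EReal)))
      (EReal.continuousAt_add (Or.inr (EReal.coe_ne_bot _)) (Or.inr (EReal.coe_ne_top _)))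
      (hmul.continuousAt.prodMk (continuous_coe_real_ereal.comp hq).continuousAt)
  have hex : ∃ X, X ∈ states d ∧ IsMinOn (barrierObjective η q) (states d) X :=
    (isCompact_states d).exists_isMinOn ⟨_, mixedState_mem hd⟩ hcont.continuousOn
  obtain ⟨hmem, hmin⟩ := Classical.epsilon_spec hex
  change argminStates (barrierObjective η q) ∈ states d at hmem
  change IsMinOn _ _ (argminStates (barrierObjective η q)) at hmin
  have hpd : (argminStates (barrierObjective η q)).PosDef := by
    rw [hmem.1.posDef_iff_det_ne_zero]
    intro h0
    have h := isMinOn_iff.1 hmin _ (mixedState_mem hd)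
    rw [barrierObjective_of_posDef η q (mixedState_posDef hd), barrierObjective, logDetBarrier,
      h0, Complex.zero_re, negLog_zero, EReal.coe_mul_top_of_pos hη', EReal.top_add_coe,
      top_le_iff] at h
    exact EReal.coe_ne_top _ h
  refine ⟨hmem, hpd, fun Z hZ hZpd => ?_⟩
  have h := isMinOn_iff.1 hmin Z hZ
  rw [barrierObjective_of_posDef η q hpd, barrierObjective_of_posDef η q hZpd] at h
  exact_mod_cast h

/-- First-order optimality of a barrier minimizer, along a segment on which the smooth part of the
objective is quadratic. -/
lemma IsBarrierMin.first_order {η : ℝ} (hη : 0 < η) {q : Mat d → ℝ} {Y Z : Mat d}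
    (hY : IsBarrierMin η q Y) (hZ : Z ∈ states d) (hZpd : Z.PosDef) {a b : ℝ}
    (hq : ∀ t : ℝ, q (Y + t • (Z - Y)) = q Y + t * a + t ^ 2 * b) :
    η⁻¹ * rtr (Y⁻¹ * (Z - Y)) ≤ a := by
  have hpd : ∀ t : ℝ, 0 < t → t < 1 → (Y + t • (Z - Y)).PosDef := by
    intro t h0 h1
    have e : Y + t • (Z - Y) = (1 - t) • Y + t • Z := by
      rw [smul_sub, sub_smul, one_smul]; abel
    rw [e]
    exact (hY.posDef.smul (by linarith)).add (hZpd.smul h0)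
  have hmem : ∀ t : ℝ, 0 < t → t < 1 → Y + t • (Z - Y) ∈ states d := by
    intro t h0 h1
    have e : Y + t • (Z - Y) = (1 - t) • Y + t • Z := by
      rw [smul_sub, sub_smul, one_smul]; abel
    rw [e]
    exact convex_states d hY.mem hZ (by linarith) h0.le (by ring)
  -- Concavity of `log det` at the moving point replaces the derivative of the determinant.
  have key : ∀ t : ℝ, 0 < t → t < 1 →
      η⁻¹ * rtr ((Y + t • (Z - Y))⁻¹ * (Z - Y)) ≤ a + t * b := by
    intro t h0 h1
    have h2 := hY.le _ (hmem t h0 h1) (hpd t h0 h1)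
    rw [hq] at h2
    have h3 := logDet_sub_le (hpd t h0 h1) hY.posDef
    have e : Y - (Y + t • (Z - Y)) = (-t) • (Z - Y) := by rw [neg_smul]; abel
    rw [e, mul_smul_comm, rtr_smul] at h3
    have h4 := mul_le_mul_of_nonneg_left h3 (inv_pos.2 hη).le
    refine le_of_mul_le_mul_left ?_ h0
    nlinarith
  have hinv : ContinuousAt (fun t : ℝ => (Y + t • (Z - Y))⁻¹) 0 := by
    have hc : Continuous fun t : ℝ => Y + t • (Z - Y) := by fun_prop
    simp only [Matrix.inv_def, Ring.inverse_eq_inv']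
    refine ContinuousAt.smul (ContinuousAt.inv₀ hc.matrix_det.continuousAt ?_)
      hc.matrix_adjugate.continuousAt
    simpa using hY.posDef.det_pos.ne'
  have hl : Filter.Tendsto (fun t : ℝ => η⁻¹ * rtr ((Y + t • (Z - Y))⁻¹ * (Z - Y)))
      (nhdsWithin 0 (Set.Ioi 0)) (nhds (η⁻¹ * rtr (Y⁻¹ * (Z - Y)))) := by
    have hc : Continuous fun A : Mat d => η⁻¹ * rtr (A * (Z - Y)) := by
      unfold rtr
      exact continuous_const.mul (Complex.continuous_re.comp (by fun_prop))
    have h := (hc.continuousAt.comp hinv).tendsto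
    simp only [Function.comp_def, zero_smul, add_zero] at h
    exact h.mono_left nhdsWithin_le_nhds
  have hr : Filter.Tendsto (fun t : ℝ => a + t * b) (nhdsWithin 0 (Set.Ioi 0)) (nhds a) := by
    have hc : Continuous fun t : ℝ => a + t * b := by fun_prop
    have h := hc.tendsto 0
    simp only [zero_mul, add_zero] at h
    exact h.mono_left nhdsWithin_le_nhds
  refine le_of_tendsto_of_tendsto hl hr ?_
  filter_upwards [Ioo_mem_nhdsGT (zero_lt_one' ℝ)] with t ht
  exact key t ht.1 ht.2

/-- Growth of a barrier-regularized quadratic objective away from its minimizer. -/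
lemma IsBarrierMin.growth {η : ℝ} (hη : 0 < η) {q : Mat d → ℝ} {Y Z : Mat d}
    (hY : IsBarrierMin η q Y) (hZ : Z ∈ states d) (hZpd : Z.PosDef) {a b : ℝ}
    (hq : ∀ t : ℝ, q (Y + t • (Z - Y)) = q Y + t * a + t ^ 2 * b) :
    η⁻¹ * (localSq Y (Z - Y) / (2 * (1 + √(localSq Y (Z - Y))))) + b ≤
      (q Z - η⁻¹ * logDet Z) - (q Y - η⁻¹ * logDet Y) := by
  have h1 := hY.first_order hη hZ hZpd hq
  have h2 := mul_le_mul_of_nonneg_left (logDet_sub_add_localSq_le hY.posDef hZpd)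
    (inv_pos.2 hη).le
  have h3 := hq 1
  rw [one_smul, add_sub_cancel] at h3
  rw [h3]
  linarith

/-- The log-det barrier is minimized by the maximally mixed state. -/
lemma IsBarrierMin.eq_mixedState (hd : 1 ≤ d) {η : ℝ} (hη : 0 < η) {Y : Mat d}
    (hY : IsBarrierMin η (fun _ => 0) Y) : Y = mixedState d := by
  have h0 : (0 : ℝ) < d := by exact_mod_cast hd
  have h1 := hY.le _ (mixedState_mem hd) (mixedState_posDef hd)
  have h2 := logDet_add_frobSq_le (hY.posDef.smul h0)
  rw [rtr_smul, rtr_of_mem_states hY.mem, logDet_smul hY.posDef h0] at h2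
  rw [logDet_mixedState hd] at h1
  have h3 : -(d * Real.log d) ≤ logDet Y := by
    have : η⁻¹ * (-(d * Real.log d)) ≤ η⁻¹ * logDet Y := by linarith
    exact le_of_mul_le_mul_left this (inv_pos.2 hη)
  simp only [Fintype.card_fin, mul_one, sub_self] at h2
  have h4 : frobSq ((d : ℝ) • Y - 1) = 0 := by
    have h5 : frobSq ((d : ℝ) • Y - 1) / (2 * (1 + √(frobSq ((d : ℝ) • Y - 1)))) ≤ 0 := by
      linarith
    refine le_antisymm (not_lt.1 fun hpos => ?_) (frobSq_nonneg _)
    exact absurd h5 (not_le.2 (div_pos hpos (by positivity)))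
  have h6 := sub_eq_zero.1 (frobSq_eq_zero h4)
  rw [mixedState, ← h6, smul_smul, inv_mul_cancel₀ h0.ne', one_smul]

end States

/-! ### Surrogate losses -/

section Surrogate

variable {d : ℕ}

lemma ip_add_left (X Y Z : Mat d) : ip (X + Y) Z = ip X Z + ip Y Z := by
  simp [ip, Matrix.conjTranspose_add, add_mul, Matrix.trace_add]

lemma ip_sub_left (X Y Z : Mat d) : ip (X - Y) Z = ip X Z - ip Y Z := by
  simp [ip, Matrix.conjTranspose_sub, sub_mul, Matrix.trace_sub]

lemma ip_smul_left (c : ℝ) (X Z : Mat d) : ip (c • X) Z = c * ip X Z := by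
  simp [ip, Matrix.conjTranspose_smul, Matrix.trace_smul]

lemma ip_sub_right (X Y Z : Mat d) : ip X (Y - Z) = ip X Y - ip X Z := by
  simp [ip, mul_sub, Matrix.trace_sub]

lemma ip_smul_right (c : ℝ) (X Z : Mat d) : ip X (c • Z) = c * ip X Z := by
  simp [ip, Matrix.trace_smul]

lemma ip_nonneg {X Y : Mat d} (hX : X.PosSemidef) (hY : Y.PosSemidef) : 0 ≤ ip X Y := by
  rw [ip_eq_rtr hX.1]
  exact rtr_mul_nonneg hX hY

lemma ip_le_one {X Y : Mat d} (hX : X ∈ states d) (hY : Y ∈ states d) : ip X Y ≤ 1 := by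
  rw [ip_eq_rtr hX.1.1]
  have := rtr_mul_le_mul_rtr hX.1 hY.1
  rwa [rtr_of_mem_states hX, rtr_of_mem_states hY, one_mul] at this

lemma ip_lossGrad (V X R : Mat d) : ip V (lossGrad X R) = -(ip V R / ip X R) := by
  have h : lossGrad X R = (-(ip X R)⁻¹) • R := by rw [lossGrad, neg_smul]
  rw [h, ip_smul_right]
  ring

lemma ip_sub_lossGrad (V : Mat d) {X R : Mat d} (h : 0 < ip X R) :
    ip (V - X) (lossGrad X R) = 1 - ip V R / ip X R := by
  rw [ip_lossGrad, ip_sub_left]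
  field_simp
  ring

/-- If `P ≽ X⁻¹`, then `X ≽ (tr P)⁻¹ I`, so every loss matrix has overlap at least `(tr P)⁻¹`
with `X`. -/
lemma inv_le_ip_of_inv_le {X P R : Mat d} (hX : X.PosDef) (hP : P.PosDef)
    (h : (P - X⁻¹).PosSemidef) (hR : R ∈ states d) : (rtr P)⁻¹ ≤ ip X R := by
  have hd : Nonempty (Fin d) := by
    by_contra hne
    have := rtr_of_mem_states hR
    rw [not_nonempty_iff] at hne
    simp [rtr, Matrix.trace] at this
  have ht : 0 < rtr P := (Complex.lt_def.1 hP.trace_pos).1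
  have h1 : ((rtr P) • (1 : Mat d) - X⁻¹).PosSemidef :=
    posSemidef_sub_trans h (rtr_smul_one_sub_posSemidef hP.posSemidef)
  have h2 := inv_sub_inv_posSemidef hX.inv h1
  have uX := hX.isUnit
  rw [Matrix.isUnit_iff_isUnit_det] at uX
  rw [Matrix.nonsing_inv_nonsing_inv _ uX] at h2
  have e : ((rtr P) • (1 : Mat d))⁻¹ = (rtr P)⁻¹ • (1 : Mat d) := by
    refine Matrix.inv_eq_left_inv ?_
    rw [smul_mul_smul_comm, one_mul, inv_mul_cancel₀ ht.ne', one_smul]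
  rw [e] at h2
  have h3 := rtr_mul_le_of_sub h2 hR.1
  rw [smul_mul_assoc, one_mul, rtr_smul, rtr_of_mem_states hR, mul_one] at h3
  rwa [ip_eq_rtr hX.1]

lemma ip_pos {X R : Mat d} (hX : X.PosDef) (hR : R ∈ states d) : 0 < ip X R := by
  have h := inv_le_ip_of_inv_le hX hX.inv (by simpa using Matrix.PosSemidef.zero) hR
  have hd : Nonempty (Fin d) := by
    by_contra hne
    have := rtr_of_mem_states hR
    rw [not_nonempty_iff] at hne
    simp [rtr, Matrix.trace] at this
  exact lt_of_lt_of_le (inv_pos.2 (Complex.lt_def.1 hX.inv.trace_pos).1) h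

/-- The gradient of the log loss has norm at most one in the barrier metric at the played state. -/
lemma abs_ip_lossGrad_le {X R D : Mat d} (hX : X.PosDef) (hR : R ∈ states d)
    (hD : D.IsHermitian) : |ip D (lossGrad X R)| ≤ √(localSq X D) := by
  have hpos := ip_pos hX hR
  obtain ⟨S, hS, rfl⟩ := exists_posDef_sq hX
  have u := hS.isUnit
  rw [Matrix.isUnit_iff_isUnit_det] at u
  have hH : (S⁻¹ * D * S⁻¹).IsHermitian := by
    have := Matrix.isHermitian_conjTranspose_mul_mul S⁻¹ hD
    rwa [hS.inv.1.eq] at this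
  have hK := conj_posSemidef hR.1 hS.1
  have e1 : ip D R = rtr (S⁻¹ * D * S⁻¹ * (S * R * S)) := by
    have e : S⁻¹ * D * S⁻¹ * (S * R * S) = S⁻¹ * (D * R * S) := by
      rw [mul_assoc S R S, mul_assoc (S⁻¹ * D), Matrix.nonsing_inv_mul_cancel_left _ _ u]
      noncomm_ring
    rw [ip_eq_rtr hD, e, rtr_mul_comm S⁻¹, Matrix.mul_nonsing_inv_cancel_right _ _ u]
  have e2 : ip (S * S) R = rtr (S * R * S) := by
    rw [ip_eq_rtr hX.1, mul_assoc, rtr_mul_comm]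
  have h1 := abs_rtr_mul_le hH hK.1
  have h2 : √(frobSq (S * R * S)) ≤ ip (S * S) R := by
    rw [e2]
    refine Real.sqrt_le_iff.2 ⟨rtr_nonneg hK, ?_⟩
    rw [frobSq_of_isHermitian hK.1, sq]
    exact rtr_mul_le_mul_rtr hK hK
  rw [ip_lossGrad, abs_neg, abs_div, abs_of_pos hpos, div_le_iff₀ hpos, localSq_eq_frobSq hS hD,
    e1]
  exact h1.trans (mul_le_mul_of_nonneg_left h2 (Real.sqrt_nonneg _))

lemma frobSq_lossGrad_le {X R : Mat d} (hR : R ∈ states d) :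
    frobSq (lossGrad X R) ≤ ((ip X R)⁻¹) ^ 2 := by
  have h : lossGrad X R = (-(ip X R)⁻¹) • R := by rw [lossGrad, neg_smul]
  have e : frobSq (lossGrad X R) = ((ip X R)⁻¹) ^ 2 * frobSq R := by
    rw [h, frobSq, Matrix.conjTranspose_smul, smul_mul_smul_comm, rtr_smul, frobSq]
    simp [sq]
  rw [e]
  exact mul_le_of_le_one_right (sq_nonneg _) (frobSq_le_one hR)

lemma lossGrad_isHermitian {X R : Mat d} (hR : R ∈ states d) :
    (lossGrad X R).IsHermitian := by
  rw [lossGrad, Matrix.IsHermitian, Matrix.conjTranspose_neg, Matrix.conjTranspose_smul,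
    hR.1.1.eq]
  simp

lemma surrogate_self (β : ℝ) (X R : Mat d) : surrogate β X R X = -Real.log (ip X R) := by
  simp [surrogate, ip]

lemma surrogate_line (β : ℝ) (X R Y D : Mat d) (t : ℝ) :
    surrogate β X R (Y + t • D) = surrogate β X R Y +
      t * (ip D (lossGrad X R) * (1 + β * ip (Y - X) (lossGrad X R))) +
      t ^ 2 * (β / 2 * ip D (lossGrad X R) ^ 2) := by
  have e : Y + t • D - X = (Y - X) + t • D := by abel
  rw [surrogate, e, ip_add_left, ip_smul_left, surrogate]
  ring

lemma continuous_ip (Z : Mat d) : Continuous fun Y : Mat d => ip Y Z := by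
  unfold ip
  exact Complex.continuous_re.comp (by fun_prop)

lemma continuous_surrogate (β : ℝ) (X R : Mat d) : Continuous (surrogate β X R) := by
  have h : Continuous fun Y : Mat d => ip (Y - X) (lossGrad X R) :=
    (continuous_ip _).comp (continuous_id.sub continuous_const)
  unfold surrogate
  fun_prop

/-- The tangent to the quadratic `y + β y² / 2` at a point `y ≥ -1 / (2 β)` minorizes
`-log (1 - ·)` on all of `(-∞, 1)`: with `a = 1 + β y ≥ 1 / 2` the slope of the tangent, the gap
reduces to `a - 1 - log a ≤ (a - 1)² / (2 β)`. -/
lemma tangent_le_neg_log {β y z : ℝ} (hβ : 0 < β) (hβ' : β ≤ 1 / 4) (hy : -(1 / (2 * β)) ≤ y)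
    (hz : z < 1) :
    y + β / 2 * y ^ 2 + (z - y) * (1 + β * y) ≤ -Real.log (1 - z) := by
  set a := 1 + β * y with ha
  have ha2 : 1 / 2 ≤ a := by
    have := mul_le_mul_of_nonneg_left hy hβ.le
    have e : β * -(1 / (2 * β)) = -(1 / 2) := by field_simp
    rw [ha]; linarith
  have ha0 : 0 < a := by linarith
  have hw : 0 < 1 - z := by linarith
  have h1 : Real.log (1 - z) ≤ a * (1 - z) - 1 - Real.log a := by
    have := Real.log_le_sub_one_of_pos (mul_pos ha0 hw)
    rw [Real.log_mul ha0.ne' hw.ne'] at this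
    linarith
  have h2 := Real.one_sub_inv_le_log_of_pos ha0
  have h3 : (a - 1) - (1 - a⁻¹) = (a - 1) ^ 2 / a := by field_simp
  have h4 : (a - 1) ^ 2 / a ≤ β / 2 * y ^ 2 := by
    have e : (a - 1) ^ 2 = β * (β * y ^ 2) := by rw [ha]; ring
    rw [div_le_iff₀ ha0, e]
    nlinarith [mul_nonneg hβ.le (sq_nonneg y)]
  have e : y + β / 2 * y ^ 2 + (z - y) * a = a * z - β / 2 * y ^ 2 := by rw [ha]; ring
  rw [e]
  linarith

/-- If the overlap of `Y` with the loss matrix exceeds that of the played state by at most the factor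
`1 / (2 β)`, then the tangent of the surrogate at `Y` minorizes the log loss everywhere. -/
lemma surrogate_tangent_le {β : ℝ} (hβ : 0 < β) (hβ' : β ≤ 1 / 4) {X R Y V : Mat d}
    (hX : 0 < ip X R) (hV : 0 < ip V R) (hY : ip Y R ≤ (2 * β)⁻¹ * ip X R) :
    surrogate β X R Y +
      ip (V - Y) (lossGrad X R) * (1 + β * ip (Y - X) (lossGrad X R)) ≤ -Real.log (ip V R) := by
  have e1 : ip (V - Y) (lossGrad X R) =
      ip (V - X) (lossGrad X R) - ip (Y - X) (lossGrad X R) := by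
    rw [← ip_sub_left]; congr 1; abel
  have hy : -(1 / (2 * β)) ≤ 1 - ip Y R / ip X R := by
    have : ip Y R / ip X R ≤ (2 * β)⁻¹ := by rwa [div_le_iff₀ hX]
    rw [one_div]; linarith
  have h := tangent_le_neg_log hβ hβ' hy (z := 1 - ip V R / ip X R) (by
    have := div_pos hV hX
    linarith)
  rw [sub_sub_cancel, Real.log_div hV.ne' hX.ne'] at h
  rw [e1, surrogate, ip_sub_lossGrad V hX, ip_sub_lossGrad Y hX]
  linarith

end Surrogate

/-! ### The dynamics within one epoch -/

section Epoch

variable {d : ℕ}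

/-- The sum of the first `n` surrogate losses, when the played states are `X`. -/
def surrogateSum (β : ℝ) (R X : ℕ → Mat d) (n : ℕ) (Y : Mat d) : ℝ :=
  ∑ k ∈ Finset.range n, surrogate β (X k) (R k) Y

/-- The sum of the first `n` surrogate losses together with the accumulated bias
`-B ⟨Y, P_n - P_0⟩`. -/
def biasedSum (B β : ℝ) (R X P : ℕ → Mat d) (n : ℕ) (Y : Mat d) : ℝ :=
  surrogateSum β R X n Y - B * ip Y (P n - P 0)

/-- The sequences of played states `X`, comparators `U` and biases `P` of an epoch without
resets; the bias in force before round `n` is `P n`. -/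
structure IsEpoch (B η β : ℝ) (R X U P : ℕ → Mat d) : Prop where
  bias_zero : P 0 = (d : ℝ) • (1 : Mat d)
  bias_succ : ∀ n, P (n + 1) = biasUpdate (P n) (X n)
  played : ∀ n, IsBarrierMin η (biasedSum B β R X P n) (X n)
  comparator : ∀ n, IsBarrierMin η (surrogateSum β R X n) (U n)

lemma surrogateSum_line (β : ℝ) (R X : ℕ → Mat d) (n : ℕ) (Y D : Mat d) (t : ℝ) :
    surrogateSum β R X n (Y + t • D) = surrogateSum β R X n Y +
      t * (∑ k ∈ Finset.range n, ip D (lossGrad (X k) (R k)) *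
        (1 + β * ip (Y - X k) (lossGrad (X k) (R k)))) +
      t ^ 2 * (β / 2 * ∑ k ∈ Finset.range n, ip D (lossGrad (X k) (R k)) ^ 2) := by
  simp only [surrogateSum, surrogate_line, Finset.sum_add_distrib, Finset.mul_sum]

lemma biasedSum_line (B β : ℝ) (R X P : ℕ → Mat d) (n : ℕ) (Y D : Mat d) (t : ℝ) :
    biasedSum B β R X P n (Y + t • D) = biasedSum B β R X P n Y +
      t * ((∑ k ∈ Finset.range n, ip D (lossGrad (X k) (R k)) *
        (1 + β * ip (Y - X k) (lossGrad (X k) (R k)))) - B * ip D (P n - P 0)) +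
      t ^ 2 * (β / 2 * ∑ k ∈ Finset.range n, ip D (lossGrad (X k) (R k)) ^ 2) := by
  rw [biasedSum, surrogateSum_line, ip_add_left, ip_smul_left, biasedSum]
  ring

namespace IsEpoch

variable {B η β : ℝ} {R X U P : ℕ → Mat d} (E : IsEpoch B η β R X U P)

include E

lemma bias_posDef (hd : 1 ≤ d) (n : ℕ) : (P n).PosDef := by
  induction n with
  | zero =>
    rw [E.bias_zero]
    exact Matrix.PosDef.one.smul (by exact_mod_cast hd)
  | succ n ih =>
    rw [E.bias_succ]
    exact biasUpdate_posDef ih (E.played n).posDef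

lemma bias_sub_inv (hd : 1 ≤ d) {k n : ℕ} (h : k ≤ n) : (P (n + 1) - (X k)⁻¹).PosSemidef := by
  induction n, h using Nat.le_induction with
  | base =>
    rw [E.bias_succ]
    exact biasUpdate_sub_inv_posSemidef (E.bias_posDef hd k) (E.played k).posDef
  | succ n _ ih =>
    refine posSemidef_sub_trans ih ?_
    rw [E.bias_succ (n + 1)]
    exact biasIncrement_posSemidef (E.played (n + 1)).posDef

lemma played_zero (hd : 1 ≤ d) (hη : 0 < η) : X 0 = mixedState d := by
  refine IsBarrierMin.eq_mixedState hd hη ?_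
  have h := E.played 0
  have e : biasedSum B β R X P 0 = fun _ => 0 := by
    funext Y
    simp [biasedSum, surrogateSum, ip]
  rwa [e] at h

lemma comparator_zero (hd : 1 ≤ d) (hη : 0 < η) : U 0 = mixedState d := by
  refine IsBarrierMin.eq_mixedState hd hη ?_
  have h := E.comparator 0
  have e : surrogateSum β R X 0 = fun _ => 0 := by
    funext Y
    simp [surrogateSum]
  rwa [e] at h

lemma inv_played_zero (hd : 1 ≤ d) (hη : 0 < η) : (X 0)⁻¹ = P 0 := by
  have h : (d : ℝ) ≠ 0 := by exact_mod_cast (by lia : d ≠ 0)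
  rw [E.played_zero hd hη, E.bias_zero, mixedState]
  refine Matrix.inv_eq_left_inv ?_
  rw [smul_mul_smul_comm, one_mul, mul_inv_cancel₀ h, one_smul]

lemma bias_one (hd : 1 ≤ d) (hη : 0 < η) : P 1 = P 0 := by
  have h0 := (E.played 0).posDef
  have h := frobSq_biasGap_le (E.bias_posDef hd 0) h0 h0
    (by rw [E.inv_played_zero hd hη, sub_self]; exact Matrix.PosSemidef.zero)
  have h1 : biasGap (P 0) (X 0) = 0 := by
    refine frobSq_eq_zero (le_antisymm (h.trans (le_of_eq ?_)) (frobSq_nonneg _))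
    simp [localSq, rtr]
  rw [E.bias_succ, biasUpdate_eq, h1]
  simp

/-- The value lost in one round of follow-the-regularized-leader, before the barrier and the
quadratic terms are used to absorb the linear ones. -/
lemma stability_le (hη : 0 < η) (k : ℕ) :
    (biasedSum B β R X P (k + 1) (X k) - η⁻¹ * logDet (X k)) -
      (biasedSum B β R X P (k + 1) (X (k + 1)) - η⁻¹ * logDet (X (k + 1))) ≤
    -(η⁻¹ * (localSq (X k) (X (k + 1) - X k) /
        (2 * (1 + √(localSq (X k) (X (k + 1) - X k)))))) -
      β / 2 * ∑ r ∈ Finset.range (k + 1), ip (X (k + 1) - X k) (lossGrad (X r) (R r)) ^ 2 -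
      ip (X (k + 1) - X k) (lossGrad (X k) (R k)) +
      B * ip (X (k + 1) - X k) (biasUpdate (P k) (X k) - P k) := by
  have h := (E.played k).growth hη (E.played (k + 1)).mem (E.played (k + 1)).posDef
    (biasedSum_line B β R X P k (X k) (X (k + 1) - X k))
  have e : ∀ Y, biasedSum B β R X P (k + 1) Y =
      biasedSum B β R X P k Y + surrogate β (X k) (R k) Y - B * ip Y (P (k + 1) - P k) := by
    intro Y
    simp only [biasedSum, surrogateSum, Finset.sum_range_succ, ip_sub_right]
    ring
  have e2 : surrogate β (X k) (R k) (X (k + 1)) = surrogate β (X k) (R k) (X k) +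
      ip (X (k + 1) - X k) (lossGrad (X k) (R k)) +
      β / 2 * ip (X (k + 1) - X k) (lossGrad (X k) (R k)) ^ 2 := by
    have := surrogate_line β (X k) (R k) (X k) (X (k + 1) - X k) 1
    rw [one_smul, add_sub_cancel, sub_self] at this
    rw [this]
    simp [ip]
  rw [e, e, e2, E.bias_succ, Finset.sum_range_succ, ip_sub_left (X (k + 1)) (X k) (_ - _)]
  linarith

lemma stability_nonneg (k : ℕ) :
    0 ≤ (biasedSum B β R X P (k + 1) (X k) - η⁻¹ * logDet (X k)) -
      (biasedSum B β R X P (k + 1) (X (k + 1)) - η⁻¹ * logDet (X (k + 1))) :=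
  sub_nonneg.2 ((E.played (k + 1)).le _ (E.played k).mem (E.played k).posDef)

lemma increment_isHermitian (k : ℕ) : (X (k + 1) - X k).IsHermitian :=
  (E.played (k + 1)).posDef.1.sub (E.played k).posDef.1

lemma localSq_le_of_gap_le (hη : 0 < η) (hη' : η ≤ 1 / 100) (hB : B = 1 / (4 * η)) (hβ : 0 < β)
    {k : ℕ} (hR : R k ∈ states d) (h : √(frobSq (biasGap (P k) (X k))) ≤ 6 * η) :
    √(localSq (X k) (X (k + 1) - X k)) ≤ 6 * η := by
  have hX := (E.played k).posDef
  have hD := E.increment_isHermitian k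
  have h1 := (E.stability_nonneg k).trans (E.stability_le hη k)
  have h2 := (abs_le.1 (abs_ip_lossGrad_le hX hR hD)).1
  have h3 := (abs_le.1 (abs_ip_biasIncrement_le (P := P k) hX hD)).2
  set s := √(localSq (X k) (X (k + 1) - X k)) with hs
  have hs0 : 0 ≤ s := Real.sqrt_nonneg _
  have hss : localSq (X k) (X (k + 1) - X k) = s ^ 2 :=
    (Real.sq_sqrt (localSq_nonneg hX hD)).symm
  rw [hss] at h1
  have hq : 0 ≤ β / 2 * ∑ r ∈ Finset.range (k + 1),
      ip (X (k + 1) - X k) (lossGrad (X r) (R r)) ^ 2 :=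
    mul_nonneg (by positivity) (Finset.sum_nonneg fun _ _ => sq_nonneg _)
  have hB0 : 0 ≤ B := by rw [hB]; positivity
  have h4 : B * ip (X (k + 1) - X k) (biasUpdate (P k) (X k) - P k) ≤ 3 / 2 * s := by
    calc _ ≤ B * (s * (6 * η)) :=
          mul_le_mul_of_nonneg_left (h3.trans (mul_le_mul_of_nonneg_left h hs0)) hB0
      _ = 3 / 2 * s := by rw [hB]; field_simp; ring
  have h5 : η⁻¹ * (s ^ 2 / (2 * (1 + s))) ≤ 5 / 2 * s := by linarith
  rcases hs0.eq_or_lt with h0 | h0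
  · rw [← h0]; positivity
  · have h6 : s ≤ 5 * η * (1 + s) := by
      rw [inv_mul_le_iff₀ hη, div_le_iff₀ (by positivity)] at h5
      nlinarith
    nlinarith

/-- Successive states are multiplicatively close, and the bias therefore grows slowly: a small gap
in one round makes the step small (`localSq_le_of_gap_le`), and a small step makes the next gap
small (`frobSq_biasGap_le`). -/
lemma gap_le (hd : 1 ≤ d) (hη : 0 < η) (hη' : η ≤ 1 / 100) (hB : B = 1 / (4 * η)) (hβ : 0 < β)
    (k : ℕ) (hR : ∀ i < k, R i ∈ states d) : √(frobSq (biasGap (P k) (X k))) ≤ 6 * η := by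
  induction k with
  | zero =>
    have h0 := (E.played 0).posDef
    have h := frobSq_biasGap_le (E.bias_posDef hd 0) h0 h0
      (by rw [E.inv_played_zero hd hη, sub_self]; exact Matrix.PosSemidef.zero)
    have h1 : localSq (X 0) (X 0 - X 0) = 0 := by simp [localSq, rtr]
    rw [h1] at h
    rw [Real.sqrt_eq_zero_of_nonpos h]
    positivity
  | succ k ih =>
    have h1 := E.localSq_le_of_gap_le hη hη' hB hβ (hR k k.lt_succ_self)
      (ih fun i hi => hR i (hi.trans k.lt_succ_self))
    exact (Real.sqrt_le_sqrt (frobSq_biasGap_le (E.bias_posDef hd _) (E.played _).posDef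
      (E.played k).posDef (E.bias_sub_inv hd le_rfl))).trans h1

/-- The stability cost of one round splits into an online Newton step term and a fraction of the
bias cost. -/
lemma stability_le_newton (hd : 1 ≤ d) (hη : 0 < η) (hη' : η ≤ 1 / 100) (hB : B = 1 / (4 * η))
    (hβ : 0 < β) (k : ℕ) (hR : ∀ i < k + 1, R i ∈ states d) :
    (biasedSum B β R X P (k + 1) (X k) - η⁻¹ * logDet (X k)) -
      (biasedSum B β R X P (k + 1) (X (k + 1)) - η⁻¹ * logDet (X (k + 1))) ≤
    (-ip (X (k + 1) - X k) (lossGrad (X k) (R k)) -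
      ((2 * η * (1 + 6 * η))⁻¹ * frobSq (X (k + 1) - X k) +
        β * ∑ r ∈ Finset.range (k + 1),
          ip (X (k + 1) - X k) (lossGrad (X r) (R r)) ^ 2) / 2) +
      1 / 2 * rtr (biasGap (P k) (X k)) := by
  have hX := (E.played k).posDef
  have hD := E.increment_isHermitian k
  have hm := E.gap_le hd hη hη' hB hβ k fun i hi => hR i (hi.trans k.lt_succ_self)
  have hs1 := E.localSq_le_of_gap_le hη hη' hB hβ (hR k k.lt_succ_self) hm
  have h1 := E.stability_le hη k
  have h3 := (abs_le.1 (abs_ip_biasIncrement_le (P := P k) hX hD)).2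
  have h4 := frobSq_le_localSq (E.played k).mem hX hD
  set s := √(localSq (X k) (X (k + 1) - X k)) with hs
  set m := √(frobSq (biasGap (P k) (X k))) with hmdef
  have hs0 : 0 ≤ s := Real.sqrt_nonneg _
  have hm0 : 0 ≤ m := Real.sqrt_nonneg _
  have hss : localSq (X k) (X (k + 1) - X k) = s ^ 2 :=
    (Real.sq_sqrt (localSq_nonneg hX hD)).symm
  have hmm : m ^ 2 ≤ 6 * η * rtr (biasGap (P k) (X k)) := by
    have hM := biasGap_posSemidef (P k) (X k)
    have h5 := rtr_mul_le_of_sub (sqrt_frobSq_smul_one_sub_posSemidef hM.1) hM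
    rw [smul_mul_assoc, one_mul, rtr_smul, ← frobSq_of_isHermitian hM.1] at h5
    rw [hmdef, Real.sq_sqrt (frobSq_nonneg _)]
    exact h5.trans (mul_le_mul_of_nonneg_right hm (rtr_nonneg hM))
  have hM0 : 0 ≤ rtr (biasGap (P k) (X k)) := rtr_nonneg (biasGap_posSemidef _ _)
  rw [hss] at h1 h4
  have hB0 : 0 ≤ B := by rw [hB]; positivity
  set κ := (2 * η * (1 + 6 * η))⁻¹ with hκ
  have hκ0 : 0 < κ := by positivity
  have h6 : κ * s ^ 2 ≤ η⁻¹ * (s ^ 2 / (2 * (1 + s))) := by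
    have e : η⁻¹ * (s ^ 2 / (2 * (1 + s))) = (2 * η * (1 + s))⁻¹ * s ^ 2 := by
      field_simp
    rw [e, hκ]
    gcongr
  -- The bias term is absorbed by half of the barrier term.
  have h7 : B * (s * m) ≤ κ / 2 * s ^ 2 + 1 / 2 * rtr (biasGap (P k) (X k)) := by
    have e1 : B * (s * m) ≤ κ / 2 * s ^ 2 + B ^ 2 / (2 * κ) * m ^ 2 := by
      have e : κ / 2 * s ^ 2 + B ^ 2 / (2 * κ) * m ^ 2 - B * (s * m) =
          (κ * s - B * m) ^ 2 / (2 * κ) := by field_simp; ring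
      have : 0 ≤ (κ * s - B * m) ^ 2 / (2 * κ) := by positivity
      linarith
    have e2 : B ^ 2 / (2 * κ) = (1 + 6 * η) / (16 * η) := by
      rw [hB, hκ]; field_simp; norm_num
    have e3 : B ^ 2 / (2 * κ) * m ^ 2 ≤ 1 / 2 * rtr (biasGap (P k) (X k)) := by
      rw [e2]
      calc _ ≤ (1 + 6 * η) / (16 * η) * (6 * η * rtr (biasGap (P k) (X k))) := by gcongr
        _ = 3 / 8 * (1 + 6 * η) * rtr (biasGap (P k) (X k)) := by field_simp; ring
        _ ≤ _ := by
          apply mul_le_mul_of_nonneg_right _ hM0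
          linarith
    linarith
  have h8 : B * ip (X (k + 1) - X k) (biasUpdate (P k) (X k) - P k) ≤ B * (s * m) :=
    mul_le_mul_of_nonneg_left h3 hB0
  have h9 : κ * frobSq (X (k + 1) - X k) ≤ κ * s ^ 2 := mul_le_mul_of_nonneg_left h4 hκ0.le
  linarith

end IsEpoch

end Epoch

/-! ### Regret on surrogates and the reset condition -/

section EpochRegret

variable {d : ℕ}

lemma trace_conjTranspose_mul_eq_ip {A B : Mat d} (hA : A.IsHermitian) (hB : B.IsHermitian) :
    (Aᴴ * B).trace = (ip A B : ℂ) := by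
  apply Complex.ext
  · simp [ip]
  · have h : star (Aᴴ * B).trace = (Aᴴ * B).trace := by
      rw [← Matrix.trace_conjTranspose, Matrix.conjTranspose_mul, Matrix.conjTranspose_conjTranspose,
        hB.eq, Matrix.trace_mul_comm, hA.eq]
    simpa using Complex.conj_eq_iff_im.1 h

lemma newton_sum_le (hd : 1 ≤ d) {κ β : ℝ} (hκ : 0 < κ) (hβ : 0 < β) (D g : ℕ → Mat d) (n : ℕ)
    (hD : ∀ k < n, (D k).IsHermitian) (hg : ∀ k < n, (g k).IsHermitian) :
    ∑ k ∈ Finset.range n, (-ip (D k) (g k) - (κ * frobSq (D k) +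
        β * ∑ r ∈ Finset.range (k + 1), ip (D k) (g r) ^ 2) / 2) ≤
      (d : ℝ) ^ 2 / (2 * β) *
        Real.log (1 + β / (κ * (d : ℝ) ^ 2) * ∑ r ∈ Finset.range n, frobSq (g r)) := by
  have : Nonempty (Fin d) := ⟨⟨0, hd⟩⟩
  have h := online_newton_potential hκ hβ (fun k => Matrix.vec (g k)) (fun k => Matrix.vec (D k)) n
  simp only [Matrix.star_vec_dotProduct_vec, Fintype.card_prod, Fintype.card_fin] at h
  have ec : (((d * d : ℕ) : ℝ)) = (d : ℝ) ^ 2 := by push_cast; ring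
  rw [ec] at h
  refine le_trans (le_of_eq (Finset.sum_congr rfl fun k hk => ?_)) h
  have hk' := Finset.mem_range.1 hk
  have e : ∀ r ∈ Finset.range (k + 1),
      ‖((D k)ᴴ * g r).trace‖ ^ 2 = ip (D k) (g r) ^ 2 := by
    intro r hr
    rw [trace_conjTranspose_mul_eq_ip (hD k hk') (hg r (lt_of_le_of_lt (Nat.lt_succ_iff.1 (Finset.mem_range.1 hr))
      hk')), Complex.norm_real, Real.norm_eq_abs, sq_abs]
  rw [Finset.sum_congr rfl e]
  rfl

namespace IsEpoch

variable {B η β : ℝ} {R X U P : ℕ → Mat d} (E : IsEpoch B η β R X U P)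

include E

/-- The regret bound of biased follow-the-regularized-leader against the surrogate losses: the
played losses are at most the surrogate objective of any comparator `V`, minus the bias `⟨V, P⟩ B`
earned by the comparator. -/
lemma played_loss_le (hd : 1 ≤ d) (hη : 0 < η) (hη' : η ≤ 1 / 100) (hB : B = 1 / (4 * η))
    (hβ : 0 < β) (n : ℕ) (hR : ∀ i < n, R i ∈ states d) {V : Mat d} (hV : V ∈ states d)
    (hVpd : V.PosDef) :
    ∑ k ∈ Finset.range n, -Real.log (ip (X k) (R k)) ≤
      (B + 1 / 2) * (logDet (P n) - d * Real.log d) +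
      (d : ℝ) ^ 2 / (2 * β) * Real.log (1 + β / ((2 * η * (1 + 6 * η))⁻¹ * (d : ℝ) ^ 2) *
        ∑ k ∈ Finset.range n, frobSq (lossGrad (X k) (R k))) +
      (surrogateSum β R X n V - η⁻¹ * logDet V) - B * ip V (P n) + B * d -
      η⁻¹ * (d * Real.log d) := by
  have hB0 : 0 ≤ B := by rw [hB]; positivity
  set J : ℕ → Mat d → ℝ := fun k Y => biasedSum B β R X P k Y - η⁻¹ * logDet Y with hJ
  have e1 : ∀ k, -Real.log (ip (X k) (R k)) =
      (J (k + 1) (X k) - J (k + 1) (X (k + 1))) + (J (k + 1) (X (k + 1)) - J k (X k)) +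
        B * rtr (biasGap (P k) (X k)) := by
    intro k
    rw [← ip_biasIncrement (E.played k).posDef, ← E.bias_succ]
    simp only [hJ, biasedSum, surrogateSum, Finset.sum_range_succ, ip_sub_right, surrogate_self]
    ring
  have e2 : ∀ k ∈ Finset.range n, -Real.log (ip (X k) (R k)) ≤
      (-ip (X (k + 1) - X k) (lossGrad (X k) (R k)) -
        ((2 * η * (1 + 6 * η))⁻¹ * frobSq (X (k + 1) - X k) +
          β * ∑ r ∈ Finset.range (k + 1),
            ip (X (k + 1) - X k) (lossGrad (X r) (R r)) ^ 2) / 2) +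
      (J (k + 1) (X (k + 1)) - J k (X k)) +
      (B + 1 / 2) * (logDet (P (k + 1)) - logDet (P k)) := by
    intro k hk
    have h1 := E.stability_le_newton hd hη hη' hB hβ k fun i hi =>
      hR i (lt_of_le_of_lt (Nat.lt_succ_iff.1 hi) (Finset.mem_range.1 hk))
    have h2 := rtr_biasGap_le (E.bias_posDef hd k) (E.played k).posDef
    rw [← E.bias_succ] at h2
    have h3 := mul_le_mul_of_nonneg_left h2 (by positivity : 0 ≤ B + 1 / 2)
    rw [e1 k]
    change J (k + 1) (X k) - J (k + 1) (X (k + 1)) ≤ _ at h1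
    linarith
  refine (Finset.sum_le_sum e2).trans ?_
  rw [Finset.sum_add_distrib, Finset.sum_add_distrib, Finset.sum_range_sub (fun k => J k (X k)),
    ← Finset.mul_sum, Finset.sum_range_sub (fun k => logDet (P k))]
  have h4 := newton_sum_le hd (κ := (2 * η * (1 + 6 * η))⁻¹) (by positivity) hβ
    (fun k => X (k + 1) - X k) (fun k => lossGrad (X k) (R k)) n
    (fun k _ => E.increment_isHermitian k) (fun k hk => lossGrad_isHermitian (hR k hk))
  have h5 : J n (X n) ≤ J n V := (E.played n).le V hV hVpd
  have h6 : J n V = surrogateSum β R X n V - η⁻¹ * logDet V - B * ip V (P n) + B * d := by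
    have h0 : ip V (P 0) = d := by
      rw [E.bias_zero, ip_smul_right, ip_eq_rtr hV.1.1, mul_one, rtr_of_mem_states hV, mul_one]
    simp only [hJ, biasedSum, ip_sub_right, h0]
    ring
  have h7 : J 0 (X 0) = η⁻¹ * (d * Real.log d) := by
    simp only [hJ]
    rw [E.played_zero hd hη, logDet_mixedState hd]
    simp [biasedSum, surrogateSum, ip]
  have h8 : logDet (P 0) = d * Real.log d := by
    rw [E.bias_zero, logDet_smul Matrix.PosDef.one (by exact_mod_cast hd), logDet_one]
    simp
  rw [h8, h7]
  linarith

/-- As `P⁻¹` is below every state played in the epoch, the condition under which the algorithm does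
not reset bounds the comparator by `1 / (2 β)` times each of them. -/
lemma comparator_ip_le (hd : 1 ≤ d) (hη : 0 < η) (hβ : 0 < β) {n : ℕ}
    (hc : ((2 * (1 + 6 * η) * β)⁻¹ • (P (n + 1))⁻¹ - U n).PosDef) {k : ℕ} (hk : k ≤ n)
    (hR : R k ∈ states d) : ip (U n) (R k) ≤ (2 * β)⁻¹ * ip (X k) (R k) := by
  have hX := (E.played k).posDef
  have hU := (E.comparator n).posDef
  have uX := hX.isUnit
  rw [Matrix.isUnit_iff_isUnit_det] at uX
  have h1 := inv_sub_inv_posSemidef hX.inv (E.bias_sub_inv hd hk)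
  rw [Matrix.nonsing_inv_nonsing_inv _ uX] at h1
  have h2 := rtr_mul_le_of_sub h1 hR.1
  have h3 := rtr_mul_le_of_sub hc.posSemidef hR.1
  rw [smul_mul_assoc, rtr_smul] at h3
  have h4 : 0 ≤ rtr ((P (n + 1))⁻¹ * R k) :=
    rtr_mul_nonneg (E.bias_posDef hd _).inv.posSemidef hR.1
  rw [ip_eq_rtr hU.1, ip_eq_rtr hX.1]
  calc _ ≤ (2 * (1 + 6 * η) * β)⁻¹ * rtr ((P (n + 1))⁻¹ * R k) := h3
    _ ≤ (2 * β)⁻¹ * rtr ((P (n + 1))⁻¹ * R k) := by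
      refine mul_le_mul_of_nonneg_right (inv_anti₀ (by positivity) ?_) h4
      nlinarith [mul_pos hη hβ]
    _ ≤ _ := mul_le_mul_of_nonneg_left h2 (by positivity)

/-- While no reset occurs, the minimum of the surrogate objective is below the true regularized
loss of every state, even where the individual surrogates exceed the true losses. -/
lemma surrogate_min_le (hd : 1 ≤ d) (hη : 0 < η) (hβ : 0 < β) (hβ' : β ≤ 1 / 4) {n : ℕ}
    (hc : ((2 * (1 + 6 * η) * β)⁻¹ • (P (n + 1))⁻¹ - U n).PosDef)
    (hR : ∀ i < n, R i ∈ states d) {V : Mat d} (hV : V ∈ states d) (hVpd : V.PosDef) :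
    surrogateSum β R X n (U n) - η⁻¹ * logDet (U n) ≤
      (∑ k ∈ Finset.range n, -Real.log (ip V (R k))) - η⁻¹ * logDet V := by
  have hU := E.comparator n
  have h1 := hU.first_order hη hV hVpd (surrogateSum_line β R X n (U n) (V - U n))
  have h2 := mul_le_mul_of_nonneg_left (logDet_sub_le hU.posDef hVpd) (inv_pos.2 hη).le
  have h3 := Finset.sum_le_sum fun k (hk : k ∈ Finset.range n) =>
    have hk' := Finset.mem_range.1 hk
    surrogate_tangent_le hβ hβ' (ip_pos (E.played k).posDef (hR k hk')) (ip_pos hVpd (hR k hk'))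
      (E.comparator_ip_le hd hη hβ hc hk'.le (hR k hk'))
  rw [Finset.sum_add_distrib] at h3
  rw [surrogateSum]
  linarith

/-- While no reset occurs, the gradients of the surrogates at the comparator are bounded, so that
the barrier keeps the comparator away from the boundary. -/
lemma rtr_inv_comparator_le (hd : 1 ≤ d) (hη : 0 < η) (hβ : 0 < β) {n : ℕ}
    (hc : ((2 * (1 + 6 * η) * β)⁻¹ • (P (n + 1))⁻¹ - U n).PosDef)
    (hR : ∀ i < n, R i ∈ states d) :
    rtr (U n)⁻¹ ≤ (d : ℝ) ^ 2 + d * η * n * ((1 + β) ^ 2 / (4 * β)) := by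
  have hU := E.comparator n
  have hd0 : (0 : ℝ) < d := by exact_mod_cast hd
  have h1 := hU.first_order hη (mixedState_mem hd) (mixedState_posDef hd)
    (surrogateSum_line β R X n (U n) (mixedState d - U n))
  have uU := hU.posDef.isUnit
  rw [Matrix.isUnit_iff_isUnit_det] at uU
  have e1 : rtr ((U n)⁻¹ * (mixedState d - U n)) = rtr (U n)⁻¹ / d - d := by
    rw [mul_sub, Matrix.nonsing_inv_mul _ uU, rtr_sub, rtr_one, mixedState, mul_smul_comm, mul_one,
      rtr_smul, Fintype.card_fin]
    ring
  have h2 : ∀ k ∈ Finset.range n, ip (mixedState d - U n) (lossGrad (X k) (R k)) *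
      (1 + β * ip (U n - X k) (lossGrad (X k) (R k))) ≤ (1 + β) ^ 2 / (4 * β) := by
    intro k hk
    have hk' := Finset.mem_range.1 hk
    have hX := ip_pos (E.played k).posDef (hR k hk')
    have hZ := ip_pos (mixedState_posDef hd) (hR k hk')
    have h3 := E.comparator_ip_le hd hη hβ hc hk'.le (hR k hk')
    have e2 : ip (mixedState d - U n) (lossGrad (X k) (R k)) =
        ip (mixedState d - X k) (lossGrad (X k) (R k)) -
          ip (U n - X k) (lossGrad (X k) (R k)) := by
      rw [← ip_sub_left]; congr 1; abel
    rw [e2, ip_sub_lossGrad _ hX, ip_sub_lossGrad _ hX]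
    have h4 : 0 < ip (mixedState d) (R k) / ip (X k) (R k) := div_pos hZ hX
    have h5 : ip (U n) (R k) / ip (X k) (R k) ≤ (2 * β)⁻¹ := by rwa [div_le_iff₀ hX]
    set w := ip (U n) (R k) / ip (X k) (R k)
    have h6 : β * w ≤ 1 / 2 := by
      have := mul_le_mul_of_nonneg_left h5 hβ.le
      have e : β * (2 * β)⁻¹ = 1 / 2 := by field_simp
      linarith
    have h7 : 0 ≤ 1 + β * (1 - w) := by nlinarith
    calc (1 - ip (mixedState d) (R k) / ip (X k) (R k) - (1 - w)) * (1 + β * (1 - w))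
        ≤ w * (1 + β * (1 - w)) := by
          apply mul_le_mul_of_nonneg_right _ h7
          linarith
      _ ≤ _ := by
        rw [le_div_iff₀ (by positivity)]
        nlinarith [sq_nonneg (1 + β - 2 * β * w)]
  have h8 := Finset.sum_le_sum h2
  rw [Finset.sum_const, Finset.card_range, nsmul_eq_mul] at h8
  have h9 := h1.trans h8
  rw [e1, inv_mul_le_iff₀ hη, sub_le_iff_le_add, div_le_iff₀ hd0] at h9
  refine h9.trans (le_of_eq ?_)
  ring

lemma rtr_bias_le (hd : 1 ≤ d) {c : ℝ} (hc0 : 0 < c) {n : ℕ}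
    (hc : (c • (P (n + 1))⁻¹ - U n).PosDef) : rtr (P (n + 1)) ≤ c * rtr (U n)⁻¹ := by
  have hP := E.bias_posDef hd (n + 1)
  have uP := hP.isUnit
  rw [Matrix.isUnit_iff_isUnit_det] at uP
  have h := inv_sub_inv_posSemidef (E.comparator n).posDef hc.posSemidef
  have e : (c • (P (n + 1))⁻¹)⁻¹ = c⁻¹ • P (n + 1) := by
    refine Matrix.inv_eq_left_inv ?_
    rw [smul_mul_smul_comm, Matrix.mul_nonsing_inv _ uP, inv_mul_cancel₀ hc0.ne', one_smul]
  rw [e] at h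
  have h2 := rtr_le_of_sub h
  rwa [rtr_smul, inv_mul_le_iff₀ hc0] at h2

/-- If the reset condition is met after round `n`, then the new comparator earns a large bias. -/
lemma le_ip_comparator_bias (hd : 1 ≤ d) (hη : 0 < η) (hη' : η ≤ 1 / 100)
    (hB : B = 1 / (4 * η)) (hβ : 0 < β) {c : ℝ} {n : ℕ} (hR : ∀ i < n + 1, R i ∈ states d)
    (hc : ¬ (c • (P (n + 1 + 1))⁻¹ - U (n + 1)).PosDef) :
    (1 - 6 * η) * c ≤ ip (U (n + 1)) (P (n + 1)) := by
  have hU := (E.comparator (n + 1)).posDef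
  have hP := E.bias_posDef hd (n + 1 + 1)
  have h1 : c ≤ rtr (P (n + 1 + 1) * U (n + 1)) := by
    by_contra hlt
    refine hc ?_
    obtain ⟨Q, hQ, hQQ⟩ := exists_posDef_sq hP
    have uQ := hQ.isUnit
    rw [Matrix.isUnit_iff_isUnit_det] at uQ
    have h2 := rtr_smul_one_sub_posSemidef (conj_posSemidef hU.posSemidef hQ.1)
    have e1 : rtr (Q * U (n + 1) * Q) = rtr (P (n + 1 + 1) * U (n + 1)) := by
      rw [rtr_mul_comm, ← mul_assoc, hQQ]
    rw [e1] at h2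
    have h3 : (c • (1 : Mat d) - Q * U (n + 1) * Q).PosDef := by
      have h4 := ((Matrix.PosDef.one (n := Fin d) (R := ℂ)).smul
        (sub_pos.2 (not_le.1 hlt))).add_posSemidef h2
      rwa [sub_smul, sub_add_sub_cancel] at h4
    have h5 := conj_posDef h3 hQ.inv
    have e2 : Q⁻¹ * (c • (1 : Mat d) - Q * U (n + 1) * Q) * Q⁻¹ =
        c • (P (n + 1 + 1))⁻¹ - U (n + 1) := by
      rw [mul_sub, sub_mul, mul_smul_comm, smul_mul_assoc, mul_one, ← Matrix.mul_inv_rev, hQQ,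
        mul_assoc Q, Matrix.nonsing_inv_mul_cancel_left _ _ uQ,
        Matrix.mul_nonsing_inv_cancel_right _ _ uQ]
    rwa [e2] at h5
  have h6 := sub_smul_biasUpdate_posSemidef (E.bias_posDef hd (n + 1)) (E.played (n + 1)).posDef
    (by positivity) (E.gap_le hd hη hη' hB hβ (n + 1) hR)
  rw [← E.bias_succ] at h6
  have h7 := rtr_mul_le_of_sub h6 hU.posSemidef
  rw [smul_mul_assoc, rtr_smul] at h7
  rw [ip_eq_rtr hU.1, rtr_mul_comm]
  exact (mul_le_mul_of_nonneg_left h1 (by linarith)).trans h7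

end IsEpoch

end EpochRegret

/-! ### The tuned parameters -/

section Tuning

variable {d T : ℕ}

lemma four_le_log (hd : 1 ≤ d) (hT : 110 * d ^ 2 ≤ T) : 4 ≤ Real.log T := by
  have h1 : 110 ≤ T := le_trans (by nlinarith [Nat.one_le_pow 2 d hd]) hT
  have h2 : (110 : ℝ) ≤ T := by exact_mod_cast h1
  rw [Real.le_log_iff_exp_le (by linarith)]
  have h3 := Real.exp_one_lt_d9
  have h4 : Real.exp 4 = Real.exp 1 ^ 4 := by rw [← Real.exp_nat_mul]; norm_num
  rw [h4]
  calc Real.exp 1 ^ 4 ≤ 2.7182818286 ^ 4 := by gcongr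
    _ ≤ 110 := by norm_num
    _ ≤ T := h2

lemma mul_log_le (hd : 1 ≤ d) (hT : 110 * d ^ 2 ≤ T) : d * Real.log T ≤ T := by
  have hL := four_le_log hd hT
  have h1 : (110 : ℝ) * d ^ 2 ≤ T := by exact_mod_cast hT
  have hT0 : (0 : ℝ) < T := lt_of_lt_of_le (by positivity) h1
  have h2 : Real.log T ≤ 2 * √T := by
    have h3 := Real.log_le_self (Real.sqrt_nonneg T)
    rw [Real.log_sqrt hT0.le] at h3
    linarith
  refine abs_le_of_sq_le_sq' ?_ hT0.le |>.2
  calc (d * Real.log T) ^ 2 = d ^ 2 * Real.log T ^ 2 := by ring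
    _ ≤ d ^ 2 * (2 * √T) ^ 2 := by gcongr
    _ = 4 * d ^ 2 * T := by rw [mul_pow, Real.sq_sqrt hT0.le]; ring
    _ ≤ (T : ℝ) ^ 2 := by nlinarith [sq_nonneg (d : ℝ)]

lemma le_biasScale (hd : 1 ≤ d) (hT : 110 * d ^ 2 ≤ T) : 211 ≤ biasScale d T := by
  have hL := four_le_log hd hT
  have h1 : (1 : ℝ) ≤ (d : ℝ) ^ 2 := one_le_pow₀ (by exact_mod_cast hd)
  rw [biasScale]
  nlinarith

lemma learningRate_pos (hd : 1 ≤ d) (hT : 110 * d ^ 2 ≤ T) : 0 < learningRate d T := by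
  have := le_biasScale hd hT
  rw [learningRate]
  positivity

lemma learningRate_le (hd : 1 ≤ d) (hT : 110 * d ^ 2 ≤ T) : learningRate d T ≤ 1 / 844 := by
  have := le_biasScale hd hT
  rw [learningRate]
  apply one_div_le_one_div_of_le (by norm_num)
  linarith

lemma biasScale_eq (hd : 1 ≤ d) (hT : 110 * d ^ 2 ≤ T) :
    biasScale d T = 1 / (4 * learningRate d T) := by
  have := le_biasScale hd hT
  rw [learningRate]
  field_simp

lemma curvature_pos (hd : 1 ≤ d) (hT : 110 * d ^ 2 ≤ T) : 0 < curvature d T := by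
  have := le_biasScale hd hT
  have h0 : (0 : ℝ) < d := by exact_mod_cast hd
  rw [curvature]
  positivity

/-- The largest overshoot `1 / (2 β)` of a comparator over the played states. -/
lemma inv_two_mul_curvature (hd : 1 ≤ d) (hT : 110 * d ^ 2 ≤ T) :
    (2 * curvature d T)⁻¹ = 84 / 5 * d * Real.log T := by
  have hL := four_le_log hd hT
  have h0 : (0 : ℝ) < d := by exact_mod_cast hd
  rw [curvature, biasScale]
  field_simp
  norm_num

lemma curvature_le (hd : 1 ≤ d) (hT : 110 * d ^ 2 ≤ T) : curvature d T ≤ 1 / 100 := by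
  have hL := four_le_log hd hT
  have h0 : (1 : ℝ) ≤ d := by exact_mod_cast hd
  have h1 := inv_two_mul_curvature hd hT
  have hβ := curvature_pos hd hT
  have h2 : 50 ≤ (2 * curvature d T)⁻¹ := by rw [h1]; nlinarith
  have h3 := (le_inv_comm₀ (by norm_num) (by positivity)).1 h2
  linarith

/-- The factor in the condition under which the algorithm does not reset. -/
def resetFactor (d T : ℕ) : ℝ := (2 * (1 + 6 * learningRate d T) * curvature d T)⁻¹

lemma resetFactor_le (hd : 1 ≤ d) (hT : 110 * d ^ 2 ≤ T) :
    resetFactor d T ≤ 84 / 5 * d * Real.log T := by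
  have hη := learningRate_pos hd hT
  have hβ := curvature_pos hd hT
  rw [← inv_two_mul_curvature hd hT, resetFactor]
  refine inv_anti₀ (by positivity) ?_
  nlinarith [mul_pos hη hβ]

lemma le_resetFactor (hd : 1 ≤ d) (hT : 110 * d ^ 2 ≤ T) :
    33 / 2 * d * Real.log T ≤ (1 - 6 * learningRate d T) * resetFactor d T := by
  have hη := learningRate_pos hd hT
  have hη' := learningRate_le hd hT
  have hβ := curvature_pos hd hT
  have hL := four_le_log hd hT
  have h0 : (0 : ℝ) < d := by exact_mod_cast hd
  have e : resetFactor d T = (2 * curvature d T)⁻¹ / (1 + 6 * learningRate d T) := by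
    rw [resetFactor]; field_simp
  rw [e, inv_two_mul_curvature hd hT, mul_div_assoc', le_div_iff₀ (by positivity)]
  have h1 : 0 < d * Real.log T := by positivity
  have h2 : 33 / 2 * (1 + 6 * learningRate d T) ≤ (1 - 6 * learningRate d T) * (84 / 5) := by
    linarith
  nlinarith

lemma resetFactor_pos (hd : 1 ≤ d) (hT : 110 * d ^ 2 ≤ T) : 0 < resetFactor d T := by
  have hη := learningRate_pos hd hT
  have hβ := curvature_pos hd hT
  rw [resetFactor]
  positivity

end Tuning

/-! ### The regret of an epoch -/

section TunedEpoch

variable {d T : ℕ} {R X U P : ℕ → Mat d}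

lemma logDet_mono {A B : Mat d} (hA : A.PosDef) (hB : B.PosDef) (h : (B - A).PosSemidef) :
    logDet A ≤ logDet B := by
  have h1 := logDet_sub_le hB hA
  have h2 := rtr_mul_nonneg hB.inv.posSemidef h
  have e : rtr (B⁻¹ * (A - B)) = -rtr (B⁻¹ * (B - A)) := by
    simp only [mul_sub, rtr_sub]
    ring
  linarith

/-- The comparator `V`, moved by weight `1 / T` towards the maximally mixed state; its barrier is
finite and its log losses exceed those of `V` by at most `2 / T`. -/
def smoothed (T : ℕ) (V : Mat d) : Mat d := (1 - (T : ℝ)⁻¹) • V + (T : ℝ)⁻¹ • mixedState d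

lemma inv_le_of_tuned (hd : 1 ≤ d) (hT : 110 * d ^ 2 ≤ T) :
    0 < (T : ℝ)⁻¹ ∧ (T : ℝ)⁻¹ ≤ 1 / 110 := by
  have h1 : 110 ≤ T := le_trans (by nlinarith [Nat.one_le_pow 2 d hd]) hT
  have h2 : (110 : ℝ) ≤ T := by exact_mod_cast h1
  refine ⟨by positivity, ?_⟩
  rw [← one_div]
  exact one_div_le_one_div_of_le (by norm_num) h2

lemma smoothed_mem (hd : 1 ≤ d) (hT : 110 * d ^ 2 ≤ T) {V : Mat d} (hV : V ∈ states d) :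
    smoothed T V ∈ states d := by
  have h := inv_le_of_tuned hd hT
  exact convex_states d hV (mixedState_mem hd) (by linarith) h.1.le (by ring)

lemma smoothed_posDef (hd : 1 ≤ d) (hT : 110 * d ^ 2 ≤ T) {V : Mat d} (hV : V ∈ states d) :
    (smoothed T V).PosDef := by
  have h := inv_le_of_tuned hd hT
  exact ((mixedState_posDef hd).smul h.1).posSemidef_add
    (hV.1.smul (by linarith : (0 : ℝ) ≤ 1 - (T : ℝ)⁻¹))

lemma neg_logDet_smoothed_le (hd : 1 ≤ d) (hT : 110 * d ^ 2 ≤ T) {V : Mat d}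
    (hV : V ∈ states d) : -logDet (smoothed T V) ≤ d * Real.log d + d * Real.log T := by
  have h := inv_le_of_tuned hd hT
  have h1 := logDet_mono ((mixedState_posDef hd).smul h.1) (smoothed_posDef hd hT hV) (by
    rw [smoothed, add_sub_cancel_right]
    exact hV.1.smul (by linarith))
  rw [logDet_smul (mixedState_posDef hd) h.1, logDet_mixedState hd, Real.log_inv,
    Fintype.card_fin] at h1
  linarith

lemma neg_log_smoothed_le (hd : 1 ≤ d) (hT : 110 * d ^ 2 ≤ T) {V Q : Mat d}
    (hQ : Q ∈ states d) (hpos : 0 < ip V Q) :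
    -Real.log (ip (smoothed T V) Q) ≤ -Real.log (ip V Q) + 2 * (T : ℝ)⁻¹ := by
  obtain ⟨h1, h2⟩ := inv_le_of_tuned hd hT
  have h3 : 0 ≤ ip (mixedState d) Q := (ip_pos (mixedState_posDef hd) hQ).le
  have h4 : (1 - (T : ℝ)⁻¹) * ip V Q ≤ ip (smoothed T V) Q := by
    rw [smoothed, ip_add_left, ip_smul_left, ip_smul_left]
    have := mul_nonneg h1.le h3
    linarith
  have h5 : 0 < 1 - (T : ℝ)⁻¹ := by linarith
  have h6 := Real.log_le_log (by positivity) h4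
  rw [Real.log_mul h5.ne' hpos.ne'] at h6
  have h7 := Real.one_sub_inv_le_log_of_pos h5
  have h8 : (1 - (T : ℝ)⁻¹)⁻¹ ≤ 1 + 2 * (T : ℝ)⁻¹ := by
    rw [inv_le_iff_one_le_mul₀ h5]
    nlinarith
  linarith

namespace IsEpoch

variable (E : IsEpoch (biasScale d T) (learningRate d T) (curvature d T) R X U P)

include E

/-- While no reset occurs, the bias has polynomial trace. -/
lemma rtr_bias_le_sq (hd : 1 ≤ d) (hT : 110 * d ^ 2 ≤ T) {n : ℕ} (hn : n ≤ T)
    (hc : (resetFactor d T • (P (n + 1))⁻¹ - U n).PosDef) (hR : ∀ i < n, R i ∈ states d) :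
    rtr (P (n + 1)) ≤ (T : ℝ) ^ 2 := by
  have hη := learningRate_pos hd hT
  have hβ := curvature_pos hd hT
  have hβ' := curvature_le hd hT
  have hL := four_le_log hd hT
  have h0 : (0 : ℝ) < d := by exact_mod_cast hd
  have h1 := E.rtr_bias_le hd (resetFactor_pos hd hT) hc
  have h2 := E.rtr_inv_comparator_le hd hη hβ hc hR
  have hT' : (110 : ℝ) * d ^ 2 ≤ T := by exact_mod_cast hT
  have hn' : (n : ℝ) ≤ T := by exact_mod_cast hn
  have e : d * learningRate d T * n * ((1 + curvature d T) ^ 2 / (4 * curvature d T)) =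
      7 / 176 * (1 + curvature d T) ^ 2 * n := by
    have hB := le_biasScale hd hT
    have e2 : learningRate d T = 7 / (44 * d) * curvature d T := by
      rw [learningRate, curvature]
      field_simp
      norm_num
    rw [e2]
    field_simp
    ring
  rw [e] at h2
  have h3 : (1 + curvature d T) ^ 2 ≤ 103 / 100 := by nlinarith
  have h4 : rtr (U n)⁻¹ ≤ T / 19 := by nlinarith
  have h5 : 0 ≤ rtr (U n)⁻¹ := rtr_nonneg (E.comparator n).posDef.inv.posSemidef
  calc rtr (P (n + 1)) ≤ resetFactor d T * rtr (U n)⁻¹ := h1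
    _ ≤ (84 / 5 * d * Real.log T) * (T / 19) :=
      mul_le_mul (resetFactor_le hd hT) h4 h5 (by positivity)
    _ ≤ (d * Real.log T) * T := by nlinarith [mul_pos h0 (by linarith : 0 < Real.log T)]
    _ ≤ T * T := mul_le_mul_of_nonneg_right (mul_log_le hd hT) (by positivity)
    _ = _ := by ring

lemma inv_sq_le_ip (hd : 1 ≤ d) (hT : 110 * d ^ 2 ≤ T) {n : ℕ} (hn : n ≤ T)
    (hc : (resetFactor d T • (P (n + 1))⁻¹ - U n).PosDef) (hR : ∀ i < n, R i ∈ states d)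
    {k : ℕ} (hk : k ≤ n) (hRk : R k ∈ states d) : ((T : ℝ) ^ 2)⁻¹ ≤ ip (X k) (R k) := by
  have : Nonempty (Fin d) := ⟨⟨0, hd⟩⟩
  have hP := E.bias_posDef hd (n + 1)
  refine le_trans (inv_anti₀ ?_ (E.rtr_bias_le_sq hd hT hn hc hR))
    (inv_le_ip_of_inv_le (E.played k).posDef hP (E.bias_sub_inv hd hk) hRk)
  exact (Complex.lt_def.1 hP.trace_pos).1

lemma logDet_bias_le (hd : 1 ≤ d) (hT : 110 * d ^ 2 ≤ T) {n : ℕ} (hn : n ≤ T)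
    (hc : (resetFactor d T • (P (n + 1))⁻¹ - U n).PosDef) (hR : ∀ i < n, R i ∈ states d)
    {N : ℕ} (hN : N = n ∨ N = n + 1) :
    logDet (P N) - d * Real.log d ≤ 2 * d * Real.log T := by
  have : Nonempty (Fin d) := ⟨⟨0, hd⟩⟩
  have h0 : (1 : ℝ) ≤ d := by exact_mod_cast hd
  have hP := E.bias_posDef hd (n + 1)
  have h1 : logDet (P N) ≤ logDet (P (n + 1)) := by
    rcases hN with rfl | rfl
    · have := E.bias_succ N
      refine logDet_mono (E.bias_posDef hd N) hP ?_
      rw [this]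
      exact biasIncrement_posSemidef (E.played N).posDef
    · exact le_rfl
  have h2 := logDet_le_card_mul_log hP
  rw [Fintype.card_fin] at h2
  have htr : 0 < rtr (P (n + 1)) := (Complex.lt_def.1 hP.trace_pos).1
  have h3 : Real.log (rtr (P (n + 1)) / d) ≤ 2 * Real.log T := by
    have h4 : rtr (P (n + 1)) / d ≤ (T : ℝ) ^ 2 :=
      (div_le_self htr.le h0).trans (E.rtr_bias_le_sq hd hT hn hc hR)
    have h5 := Real.log_le_log (by positivity) h4
    rwa [Real.log_pow, Nat.cast_ofNat] at h5
  have h6 : 0 ≤ d * Real.log d := mul_nonneg (by linarith) (Real.log_nonneg h0)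
  have h7 := mul_le_mul_of_nonneg_left h3 (by linarith : (0 : ℝ) ≤ d)
  linarith

/-- The played losses of an epoch are at most the surrogate objective of any comparator `V`, up to
`O(d³ log² T)` and the bias earned by `V`. -/
lemma tuned_played_loss_le (hd : 1 ≤ d) (hT : 110 * d ^ 2 ≤ T) {n N : ℕ} (hn : n ≤ T)
    (hN : N = n ∨ N = n + 1) (hNT : N ≤ T)
    (hc : (resetFactor d T • (P (n + 1))⁻¹ - U n).PosDef) (hR : ∀ i < N, R i ∈ states d)
    {V : Mat d} (hV : V ∈ states d) (hVpd : V.PosDef) :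
    ∑ k ∈ Finset.range N, -Real.log (ip (X k) (R k)) ≤
      204 * d ^ 3 * Real.log T ^ 2 +
      (surrogateSum (curvature d T) R X N V - (learningRate d T)⁻¹ * logDet V) -
      (learningRate d T)⁻¹ * (d * Real.log d) - biasScale d T * ip V (P N) := by
  have hη := learningRate_pos hd hT
  have hη' := learningRate_le hd hT
  have hβ := curvature_pos hd hT
  have hβ' := curvature_le hd hT
  have hL := four_le_log hd hT
  have hB := le_biasScale hd hT
  have h0 : (1 : ℝ) ≤ d := by exact_mod_cast hd
  have hRn : ∀ i < n, R i ∈ states d := fun i hi => hR i (by lia)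
  have hT1 : (1 : ℝ) ≤ T := by
    exact_mod_cast (by nlinarith [Nat.one_le_pow 2 d hd] : 1 ≤ T)
  have h1 := E.played_loss_le hd hη (by linarith) (biasScale_eq hd hT) hβ N hR hV hVpd
  have h2 := mul_le_mul_of_nonneg_left (E.logDet_bias_le hd hT hn hc hRn hN)
    (by linarith : 0 ≤ biasScale d T + 1 / 2)
  have h3 : ∑ k ∈ Finset.range N, frobSq (lossGrad (X k) (R k)) ≤ (T : ℝ) ^ 5 := by
    calc _ ≤ ∑ k ∈ Finset.range N, (T : ℝ) ^ 4 := by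
          refine Finset.sum_le_sum fun k hk => (frobSq_lossGrad_le
            (hR k (Finset.mem_range.1 hk))).trans ?_
          have hk' := Finset.mem_range.1 hk
          have h4 := E.inv_sq_le_ip hd hT hn hc hRn (by lia : k ≤ n) (hR k hk')
          have h5 := (inv_le_comm₀ (by positivity)
            (ip_pos (E.played k).posDef (hR k hk'))).1 h4
          calc ((ip (X k) (R k))⁻¹) ^ 2 ≤ ((T : ℝ) ^ 2) ^ 2 :=
                pow_le_pow_left₀ (inv_nonneg.2 (ip_pos (E.played k).posDef (hR k hk')).le) h5 2
            _ = _ := by ring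
      _ = N * (T : ℝ) ^ 4 := by simp
      _ ≤ T * (T : ℝ) ^ 4 := by gcongr
      _ = _ := by ring
  have h3' : 0 ≤ ∑ k ∈ Finset.range N, frobSq (lossGrad (X k) (R k)) :=
    Finset.sum_nonneg fun _ _ => frobSq_nonneg _
  -- The ratio of the quadratic and the barrier curvature is small enough to be dropped.
  have h4 : curvature d T / ((2 * learningRate d T * (1 + 6 * learningRate d T))⁻¹ *
      (d : ℝ) ^ 2) ≤ 1 / 2 := by
    have h5 : 1 ≤ (2 * learningRate d T * (1 + 6 * learningRate d T))⁻¹ :=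
      (one_le_inv₀ (by positivity)).2 (by nlinarith)
    have h6 : (1 : ℝ) ≤ (d : ℝ) ^ 2 := one_le_pow₀ h0
    rw [div_le_iff₀ (by positivity)]
    nlinarith
  have h4' : 0 ≤ curvature d T / ((2 * learningRate d T * (1 + 6 * learningRate d T))⁻¹ *
      (d : ℝ) ^ 2) := by positivity
  have h5 : Real.log (1 + curvature d T / ((2 * learningRate d T *
      (1 + 6 * learningRate d T))⁻¹ * (d : ℝ) ^ 2) *
        ∑ k ∈ Finset.range N, frobSq (lossGrad (X k) (R k))) ≤ 5 * Real.log T := by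
    have h6 : (2 : ℝ) ≤ (T : ℝ) ^ 5 := by
      have h7 : (2 : ℝ) ≤ T := by
        exact_mod_cast (by nlinarith [Nat.one_le_pow 2 d hd] : 2 ≤ T)
      calc (2 : ℝ) ≤ T := h7
        _ ≤ (T : ℝ) ^ 5 := le_self_pow₀ hT1 (by norm_num)
    have h7 := mul_le_mul h4 h3 h3' (by norm_num)
    have h8 := Real.log_le_log (by positivity) (by linarith :
      1 + curvature d T / ((2 * learningRate d T *
      (1 + 6 * learningRate d T))⁻¹ * (d : ℝ) ^ 2) *
        ∑ k ∈ Finset.range N, frobSq (lossGrad (X k) (R k)) ≤ (T : ℝ) ^ 5)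
    rwa [Real.log_pow, Nat.cast_ofNat] at h8
  have h6 : (d : ℝ) ^ 2 / (2 * curvature d T) = 84 / 5 * d ^ 3 * Real.log T := by
    rw [div_eq_mul_inv, inv_two_mul_curvature hd hT]
    ring
  rw [h6] at h1
  have h7 := mul_le_mul_of_nonneg_left h5 (by positivity : 0 ≤ 84 / 5 * (d : ℝ) ^ 3 * Real.log T)
  have h8 : (biasScale d T + 1 / 2) * (2 * d * Real.log T) + 84 / 5 * d ^ 3 * Real.log T *
      (5 * Real.log T) + biasScale d T * d ≤ 204 * d ^ 3 * Real.log T ^ 2 := by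
    rw [biasScale]
    have h9 : (d : ℝ) * Real.log T ≤ 1 / 4 * (d ^ 3 * Real.log T ^ 2) := by
      have h10 : (1 : ℝ) ≤ (d : ℝ) ^ 2 := one_le_pow₀ h0
      have h11 : 1 ≤ 1 / 4 * (d ^ 2 * Real.log T) := by nlinarith
      calc (d : ℝ) * Real.log T = d * Real.log T * 1 := by ring
        _ ≤ d * Real.log T * (1 / 4 * (d ^ 2 * Real.log T)) := by gcongr
        _ = _ := by ring
    have h10 : (d : ℝ) ^ 3 * Real.log T ≤ 1 / 4 * (d ^ 3 * Real.log T ^ 2) := by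
      calc (d : ℝ) ^ 3 * Real.log T = d ^ 3 * Real.log T * 1 := by ring
        _ ≤ d ^ 3 * Real.log T * (1 / 4 * Real.log T) := by gcongr; linarith
        _ = _ := by ring
    nlinarith [pow_pos (by linarith : (0 : ℝ) < d) 3, h9, h10]
  linarith

lemma regularized_comparator_le (hd : 1 ≤ d) (hT : 110 * d ^ 2 ≤ T) {n N : ℕ} (hN : N ≤ T)
    (hnN : n ≤ N)
    (hc : (resetFactor d T • (P (n + 1))⁻¹ - U n).PosDef) (hR : ∀ i < N, R i ∈ states d)
    {V : Mat d} (hV : V ∈ states d) (hpos : ∀ i < N, 0 < ip V (R i)) :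
    surrogateSum (curvature d T) R X n (U n) - (learningRate d T)⁻¹ * logDet (U n) ≤
      (∑ k ∈ Finset.range N, -Real.log (ip V (R k))) + 2 +
        (learningRate d T)⁻¹ * (d * Real.log d) + 212 * d ^ 3 * Real.log T ^ 2 := by
  have hη := learningRate_pos hd hT
  have hβ := curvature_pos hd hT
  have hβ' := curvature_le hd hT
  have hB := le_biasScale hd hT
  have hW := smoothed_mem hd hT hV
  have hWpd := smoothed_posDef hd hT hV
  have h1 := E.surrogate_min_le hd hη hβ (by linarith) hc (fun i hi => hR i (by lia)) hW hWpd
  have h2 : ∑ k ∈ Finset.range n, -Real.log (ip (smoothed T V) (R k)) ≤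
      ∑ k ∈ Finset.range N, -Real.log (ip (smoothed T V) (R k)) := by
    refine Finset.sum_le_sum_of_subset_of_nonneg (Finset.range_mono hnN) fun k hk _ => ?_
    have hk' := Finset.mem_range.1 hk
    exact neg_nonneg.2 (Real.log_nonpos (ip_nonneg hW.1 (hR k hk').1) (ip_le_one hW (hR k hk')))
  have h3 : ∑ k ∈ Finset.range N, -Real.log (ip (smoothed T V) (R k)) ≤
      (∑ k ∈ Finset.range N, -Real.log (ip V (R k))) + 2 := by
    have h4 := Finset.sum_le_sum fun k (hk : k ∈ Finset.range N) =>
      have hk' := Finset.mem_range.1 hk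
      neg_log_smoothed_le hd hT (hR k hk') (hpos k hk')
    rw [Finset.sum_add_distrib, Finset.sum_const, Finset.card_range, nsmul_eq_mul] at h4
    have h5 : (N : ℝ) * (2 * (T : ℝ)⁻¹) ≤ 2 := by
      have hi := (inv_le_of_tuned hd hT).1
      have hT0 : (0 : ℝ) < T := inv_pos.1 hi
      have : (N : ℝ) ≤ T := by exact_mod_cast hN
      calc (N : ℝ) * (2 * (T : ℝ)⁻¹) ≤ T * (2 * (T : ℝ)⁻¹) := by gcongr
        _ = 2 := by field_simp
    linarith
  have h4 := mul_le_mul_of_nonneg_left (neg_logDet_smoothed_le hd hT hV) (inv_pos.2 hη).le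
  have h5 : (learningRate d T)⁻¹ * (d * Real.log T) ≤ 212 * d ^ 3 * Real.log T ^ 2 := by
    have e : (learningRate d T)⁻¹ = 4 * biasScale d T := by rw [learningRate]; simp
    rw [e, biasScale]
    have : 0 ≤ (d : ℝ) ^ 3 * Real.log T ^ 2 := by positivity
    nlinarith
  linarith

/-- The regret of an epoch that has not ended. -/
lemma regret_le (hd : 1 ≤ d) (hT : 110 * d ^ 2 ≤ T) {n : ℕ} (hn : n ≤ T)
    (hc : (resetFactor d T • (P (n + 1))⁻¹ - U n).PosDef) (hR : ∀ i < n, R i ∈ states d)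
    {V : Mat d} (hV : V ∈ states d) (hpos : ∀ i < n, 0 < ip V (R i)) :
    ∑ k ∈ Finset.range n, (-Real.log (ip (X k) (R k)) + Real.log (ip V (R k))) ≤
      417 * d ^ 3 * Real.log T ^ 2 := by
  have hL := four_le_log hd hT
  have hB := le_biasScale hd hT
  have h0 : (1 : ℝ) ≤ d := by exact_mod_cast hd
  have hU := E.comparator n
  have h1 := E.tuned_played_loss_le hd hT hn (Or.inl rfl) hn hc hR hU.mem hU.posDef
  have h2 := E.regularized_comparator_le hd hT hn le_rfl hc hR hV hpos
  have h3 : 0 ≤ biasScale d T * ip (U n) (P n) :=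
    mul_nonneg (by linarith) (ip_nonneg hU.mem.1 (E.bias_posDef hd n).posSemidef)
  rw [Finset.sum_neg_distrib] at h2
  rw [Finset.sum_add_distrib]
  have h4 : (1 : ℝ) ≤ d ^ 3 := one_le_pow₀ h0
  have h5 : 2 ≤ (d : ℝ) ^ 3 * Real.log T ^ 2 := by nlinarith
  linarith

/-- An epoch that ends with a reset has nonpositive regret: the final comparator violates the
stability condition, so the bias it has earned outweighs all costs of the epoch. -/
lemma regret_nonpos (hd : 1 ≤ d) (hT : 110 * d ^ 2 ≤ T) {n : ℕ} (hn : n + 1 ≤ T)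
    (hc : (resetFactor d T • (P (n + 1))⁻¹ - U n).PosDef)
    (hreset : ¬ (resetFactor d T • (P (n + 1 + 1))⁻¹ - U (n + 1)).PosDef)
    (hR : ∀ i < n + 1, R i ∈ states d)
    {V : Mat d} (hV : V ∈ states d) (hpos : ∀ i < n + 1, 0 < ip V (R i)) :
    ∑ k ∈ Finset.range (n + 1), (-Real.log (ip (X k) (R k)) + Real.log (ip V (R k))) ≤ 0 := by
  have hη := learningRate_pos hd hT
  have hη' := learningRate_le hd hT
  have hβ := curvature_pos hd hT
  have hβ' := curvature_le hd hT
  have hL := four_le_log hd hT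
  have hB := le_biasScale hd hT
  have h0 : (1 : ℝ) ≤ d := by exact_mod_cast hd
  have hU := E.comparator (n + 1)
  have hUn := E.comparator n
  have hRn := hR n n.lt_succ_self
  have hX := ip_pos (E.played n).posDef hRn
  have h1 := E.tuned_played_loss_le hd hT (by lia) (Or.inr rfl) hn hc hR hU.mem hU.posDef
  have h2 := E.regularized_comparator_le hd hT hn n.le_succ hc hR hV hpos
  -- The new comparator is no worse than the old one, which pays only for the last surrogate.
  have h3 := hU.le (U n) hUn.mem hUn.posDef
  have h4 : surrogateSum (curvature d T) R X (n + 1) (U n) =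
      surrogateSum (curvature d T) R X n (U n) + surrogate (curvature d T) (X n) (R n) (U n) := by
    rw [surrogateSum, Finset.sum_range_succ, surrogateSum]
  have h5 : surrogate (curvature d T) (X n) (R n) (U n) ≤ 2 * Real.log T + 2 := by
    have h6 := E.inv_sq_le_ip hd hT (by lia) hc (fun i hi => hR i (by lia)) le_rfl hRn
    have h7 := Real.log_le_log (by
      rw [← inv_pow]; exact pow_pos (inv_le_of_tuned hd hT).1 2) h6
    rw [Real.log_inv, Real.log_pow, Nat.cast_ofNat] at h7
    have h8 := E.comparator_ip_le hd hη hβ hc le_rfl hRn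
    have h9 : ip (U n) (R n) / ip (X n) (R n) ≤ (2 * curvature d T)⁻¹ := by
      rwa [div_le_iff₀ hX]
    have h10 : 0 ≤ ip (U n) (R n) / ip (X n) (R n) :=
      div_nonneg (ip_nonneg hUn.mem.1 hRn.1) hX.le
    rw [surrogate, ip_sub_lossGrad _ hX]
    set w := ip (U n) (R n) / ip (X n) (R n)
    have h11 : curvature d T * w ≤ 1 / 2 := by
      have := mul_le_mul_of_nonneg_left h9 hβ.le
      have e : curvature d T * (2 * curvature d T)⁻¹ = 1 / 2 := by field_simp
      linarith
    have h12 : curvature d T / 2 * (1 - w) ^ 2 ≤ curvature d T / 2 + w / 4 := by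
      nlinarith
    linarith
  have h6 := E.le_ip_comparator_bias hd hη (by linarith) (biasScale_eq hd hT) hβ hR hreset
  have h7 : 871 * (d ^ 3 * Real.log T ^ 2) ≤ biasScale d T * ip (U (n + 1)) (P (n + 1)) := by
    calc 871 * (d ^ 3 * Real.log T ^ 2) ≤ biasScale d T * (33 / 2 * d * Real.log T) := by
          rw [biasScale]
          have : 0 ≤ (d : ℝ) ^ 3 * Real.log T ^ 2 := by positivity
          nlinarith
      _ ≤ _ := mul_le_mul_of_nonneg_left ((le_resetFactor hd hT).trans h6) (by linarith)
  rw [Finset.sum_neg_distrib] at h2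
  rw [Finset.sum_add_distrib]
  have h8 : (1 : ℝ) ≤ d ^ 3 := one_le_pow₀ h0
  have h9 : 2 * Real.log T + 4 ≤ (d : ℝ) ^ 3 * Real.log T ^ 2 := by nlinarith
  linarith

/-- The stability condition holds at the start of an epoch. -/
lemma not_reset_zero (hd : 1 ≤ d) (hT : 110 * d ^ 2 ≤ T) :
    (resetFactor d T • (P (0 + 1))⁻¹ - U 0).PosDef := by
  have hη := learningRate_pos hd hT
  have hL := four_le_log hd hT
  have h0 : (1 : ℝ) ≤ d := by exact_mod_cast hd
  have u := (E.played 0).posDef.isUnit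
  rw [Matrix.isUnit_iff_isUnit_det] at u
  rw [zero_add, E.bias_one hd hη, ← E.inv_played_zero hd hη, Matrix.nonsing_inv_nonsing_inv _ u,
    E.played_zero hd hη, E.comparator_zero hd hη]
  have h1 : 1 < resetFactor d T := by
    have h2 := le_resetFactor hd hT
    have h3 := resetFactor_pos hd hT
    have h4 := learningRate_le hd hT
    nlinarith
  have h2 := (mixedState_posDef hd).smul (sub_pos.2 h1)
  rwa [sub_smul, one_smul] at h2

end IsEpoch

end TunedEpoch

/-! ### The algorithm as a concatenation of epochs -/

section Algorithm

variable {d : ℕ}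

/-- One round without the reset test. -/
def advance (B β : ℝ) (s : State d) (R : Mat d) : State d :=
  let F' : Mat d → EReal := fun X => s.F X + (surrogate β s.X R X : EReal)
  let G' : Mat d → EReal := fun X =>
    s.G X + ((surrogate β s.X R X - ip X (s.P - s.Pprev) * B : ℝ) : EReal)
  { X := argminStates G', U := argminStates F', Pprev := s.P,
    P := biasUpdate s.P (argminStates G'), F := F', G := G' }

open Classical in
lemma step_eq (B η β : ℝ) (s : State d) (R : Mat d) :
    step B η β s R =
      if ((2 * (1 + 6 * η) * β)⁻¹ • (advance B β s R).P⁻¹ - (advance B β s R).U).PosDef then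
        advance B β s R
      else initState d η := rfl

/-- The state after `n` rounds of an epoch without resets. -/
def run (B η β : ℝ) (R : ℕ → Mat d) : ℕ → State d
  | 0 => initState d η
  | n + 1 => advance B β (run B η β R n) (R n)

lemma run_P (B η β : ℝ) (R : ℕ → Mat d) (n : ℕ) :
    (run B η β R n).P = biasUpdate (run B η β R n).Pprev (run B η β R n).X := by
  cases n <;> rfl

lemma run_X (B η β : ℝ) (R : ℕ → Mat d) (n : ℕ) :
    (run B η β R n).X = argminStates (run B η β R n).G := by
  cases n <;> rfl

lemma run_U (B η β : ℝ) (R : ℕ → Mat d) (n : ℕ) :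
    (run B η β R n).U = argminStates (run B η β R n).F := by
  cases n <;> rfl

lemma barrierObjective_add (η : ℝ) (q r : Mat d → ℝ) :
    (fun X => barrierObjective η q X + (r X : EReal)) =
      barrierObjective η fun X => q X + r X := by
  funext X
  rw [barrierObjective, barrierObjective, add_assoc, EReal.coe_add]

lemma run_F (B η β : ℝ) (R : ℕ → Mat d) (n : ℕ) :
    (run B η β R n).F =
      barrierObjective η (surrogateSum β R (fun k => (run B η β R k).X) n) := by
  induction n with
  | zero =>
    funext X
    simp [run, initState, barrierObjective, surrogateSum]
  | succ n ih =>
    change (fun X => (run B η β R n).F X + (surrogate β (run B η β R n).X (R n) X : EReal)) = _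
    rw [ih, barrierObjective_add]
    congr 1
    funext X
    rw [surrogateSum, surrogateSum, Finset.sum_range_succ]

lemma run_G (B η β : ℝ) (R : ℕ → Mat d) (n : ℕ) :
    (run B η β R n).G =
      barrierObjective η (biasedSum B β R (fun k => (run B η β R k).X)
        (fun k => (run B η β R k).Pprev) n) := by
  induction n with
  | zero =>
    funext X
    simp [run, initState, barrierObjective, surrogateSum, biasedSum, ip]
  | succ n ih =>
    change (fun X => (run B η β R n).G X + ((surrogate β (run B η β R n).X (R n) X -
      ip X ((run B η β R n).P - (run B η β R n).Pprev) * B : ℝ) : EReal)) = _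
    rw [ih, barrierObjective_add]
    congr 1
    funext X
    have e : (run B η β R (n + 1)).Pprev = (run B η β R n).P := rfl
    simp only [biasedSum, surrogateSum, Finset.sum_range_succ, e, ip_sub_right]
    ring

lemma continuous_surrogateSum (β : ℝ) (R X : ℕ → Mat d) (n : ℕ) :
    Continuous (surrogateSum β R X n) := by
  unfold surrogateSum
  exact continuous_finsetSum _ fun k _ => continuous_surrogate β (X k) (R k)

lemma continuous_biasedSum (B β : ℝ) (R X P : ℕ → Mat d) (n : ℕ) :
    Continuous (biasedSum B β R X P n) := by
  unfold biasedSum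
  exact (continuous_surrogateSum β R X n).sub (continuous_const.mul (continuous_ip _))

lemma isEpoch_run (hd : 1 ≤ d) {B η β : ℝ} (hη : 0 < η) (R : ℕ → Mat d) :
    IsEpoch B η β R (fun k => (run B η β R k).X) (fun k => (run B η β R k).U)
      (fun k => (run B η β R k).Pprev) where
  bias_zero := rfl
  bias_succ n := run_P B η β R n
  played n := by
    rw [run_X, run_G]
    exact isBarrierMin_argminStates hd hη (continuous_biasedSum _ _ _ _ _ _)
  comparator n := by
    rw [run_U, run_F]
    exact isBarrierMin_argminStates hd hη (continuous_surrogateSum _ _ _ _)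

/-- The reset-free run of the tuned algorithm on the loss matrices from round `t` on. -/
def tunedRun (T : ℕ) (R : ℕ → Mat d) (t : ℕ) : ℕ → State d :=
  run (biasScale d T) (learningRate d T) (curvature d T) fun k => R (t + k)

/-- The condition under which the tuned algorithm does not reset. -/
def IsStable (T : ℕ) (s : State d) : Prop := (resetFactor d T • s.P⁻¹ - s.U).PosDef

/-- At any time the algorithm is in round `n` of an epoch that began in round `t₀`, and the
epochs that ended before have nonpositive regret in total. -/
lemma exists_epoch {T : ℕ} (hd : 1 ≤ d) (hT : 110 * d ^ 2 ≤ T) {R : ℕ → Mat d}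
    (hR : ∀ t < T, R t ∈ states d) {V : Mat d} (hV : V ∈ states d)
    (hpos : ∀ t < T, 0 < ip V (R t)) (t : ℕ) (ht : t ≤ T) :
    ∃ t₀ n, t = t₀ + n ∧ IsStable T (tunedRun T R t₀ n) ∧
      (∀ k ≤ n, play T R (t₀ + k) = (tunedRun T R t₀ k).X) ∧
      stateAt (biasScale d T) (learningRate d T) (curvature d T) R t = tunedRun T R t₀ n ∧
      ∑ i ∈ Finset.range t₀, (-Real.log (ip (play T R i) (R i)) + Real.log (ip V (R i))) ≤ 0 := by
  have hη := learningRate_pos hd hT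
  have hE := fun t₀ => isEpoch_run hd (B := biasScale d T) (β := curvature d T) hη
    fun k => R (t₀ + k)
  have hzero : ∀ t₀, IsStable T (tunedRun T R t₀ 0) := fun t₀ => by
    have h := (hE t₀).not_reset_zero hd hT
    exact h
  induction t with
  | zero =>
    refine ⟨0, 0, rfl, hzero 0, fun k hk => ?_, rfl, by simp⟩
    rw [Nat.le_zero.1 hk]
    rfl
  | succ t ih =>
    obtain ⟨t₀, n, rfl, hst, hplay, hstate, hsum⟩ := ih (by lia)
    have hstep : stateAt (biasScale d T) (learningRate d T) (curvature d T) R (t₀ + n + 1) =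
        step (biasScale d T) (learningRate d T) (curvature d T) (tunedRun T R t₀ n)
          (R (t₀ + n)) := by
      rw [← hstate]; rfl
    rw [step_eq] at hstep
    have hadv : advance (biasScale d T) (curvature d T) (tunedRun T R t₀ n)
        (R (t₀ + n)) = tunedRun T R t₀ (n + 1) := rfl
    rw [hadv] at hstep
    by_cases hc : IsStable T (tunedRun T R t₀ (n + 1))
    · replace hstep := hstep.trans (if_pos hc)
      refine ⟨t₀, n + 1, rfl, hc, fun k hk => ?_, hstep, hsum⟩
      rcases Nat.le_succ_iff.1 hk with hk | rfl
      · exact hplay k hk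
      · exact congrArg State.X hstep
    · replace hstep := hstep.trans (if_neg hc)
      refine ⟨t₀ + n + 1, 0, rfl, hzero _, fun k hk => ?_, hstep, ?_⟩
      · rw [Nat.le_zero.1 hk]
        exact congrArg State.X hstep
      · have h := (hE t₀).regret_nonpos hd hT (n := n) (by lia) hst hc
          (fun i hi => hR _ (by lia)) hV (fun i hi => hpos _ (by lia))
        rw [add_assoc, Finset.sum_range_add]
        have e : ∑ k ∈ Finset.range (n + 1), (-Real.log (ip (play T R (t₀ + k)) (R (t₀ + k))) +
            Real.log (ip V (R (t₀ + k)))) ≤ 0 := by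
          refine le_trans (le_of_eq (Finset.sum_congr rfl fun k hk => ?_)) h
          rw [hplay k (Nat.lt_succ_iff.1 (Finset.mem_range.1 hk))]
          rfl
        linarith

lemma play_posDef {T : ℕ} (hd : 1 ≤ d) (hT : 110 * d ^ 2 ≤ T) {R : ℕ → Mat d}
    (hR : ∀ t < T, R t ∈ states d) {t : ℕ} (ht : t ≤ T) : (play T R t).PosDef := by
  have hpos : ∀ t < T, 0 < ip (mixedState d) (R t) := fun t ht =>
    ip_pos (mixedState_posDef hd) (hR t ht)
  obtain ⟨t₀, n, rfl, -, hplay, -⟩ := exists_epoch hd hT hR (mixedState_mem hd) hpos t ht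
  rw [hplay n le_rfl]
  exact ((isEpoch_run hd (learningRate_pos hd hT) _).played n).posDef

lemma sum_regret_le {T : ℕ} (hd : 1 ≤ d) (hT : 110 * d ^ 2 ≤ T) {R : ℕ → Mat d}
    (hR : ∀ t < T, R t ∈ states d) {V : Mat d} (hV : V ∈ states d)
    (hpos : ∀ t < T, 0 < ip V (R t)) :
    ∑ i ∈ Finset.range T, (-Real.log (ip (play T R i) (R i)) + Real.log (ip V (R i))) ≤
      417 * d ^ 3 * Real.log T ^ 2 := by
  obtain ⟨t₀, n, hTn, hst, hplay, -, hsum⟩ := exists_epoch hd hT hR hV hpos T le_rfl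
  have h := (isEpoch_run hd (B := biasScale d T) (β := curvature d T) (learningRate_pos hd hT)
    fun k => R (t₀ + k)).regret_le hd hT (n := n) (by lia) hst
    (fun i hi => hR _ (by lia)) hV (fun i hi => hpos _ (by lia))
  have e : ∑ i ∈ Finset.range T, (-Real.log (ip (play T R i) (R i)) + Real.log (ip V (R i))) =
      ∑ i ∈ Finset.range t₀, (-Real.log (ip (play T R i) (R i)) + Real.log (ip V (R i))) +
      ∑ k ∈ Finset.range n, (-Real.log (ip (play T R (t₀ + k)) (R (t₀ + k))) +
        Real.log (ip V (R (t₀ + k)))) := by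
    rw [← Finset.sum_range_add, ← hTn]
  rw [e]
  have e2 : ∑ k ∈ Finset.range n, (-Real.log (ip (play T R (t₀ + k)) (R (t₀ + k))) +
      Real.log (ip V (R (t₀ + k)))) ≤ 417 * d ^ 3 * Real.log T ^ 2 := by
    refine le_trans (le_of_eq (Finset.sum_congr rfl fun k hk => ?_)) h
    rw [hplay k (Finset.mem_range.1 hk).le]
    rfl
  linarith

lemma coe_sum_ereal {α : Type*} (s : Finset α) (f : α → ℝ) :
    ((∑ i ∈ s, f i : ℝ) : EReal) = ∑ i ∈ s, (f i : EReal) :=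
  map_sum (⟨⟨Real.toEReal, EReal.coe_zero⟩, EReal.coe_add⟩ : ℝ →+ EReal) f s

lemma regretAgainst_le {T : ℕ} (hd : 1 ≤ d) (hT : 110 * d ^ 2 ≤ T) {R : ℕ → Mat d}
    (hR : ∀ t < T, R t ∈ states d) {V : Mat d} (hV : V ∈ states d) :
    regretAgainst T R V ≤ ((417 * (d : ℝ) ^ 3 * Real.log T ^ 2 : ℝ) : EReal) := by
  rw [regretAgainst]
  have hplay : ∀ t < T, loss (play T R t) (R t) =
      ((-Real.log (ip (play T R t) (R t)) : ℝ) : EReal) := fun t ht =>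
    negLog_of_pos (ip_pos (play_posDef hd hT hR ht.le) (hR t ht))
  by_cases hpos : ∀ t < T, 0 < ip V (R t)
  · have e : ∑ t ∈ Finset.range T, (loss (play T R t) (R t) - loss V (R t)) =
        ((∑ t ∈ Finset.range T,
          (-Real.log (ip (play T R t) (R t)) + Real.log (ip V (R t))) : ℝ) : EReal) := by
      rw [coe_sum_ereal]
      refine Finset.sum_congr rfl fun t ht => ?_
      have ht' := Finset.mem_range.1 ht
      rw [hplay t ht', loss, negLog_of_pos (hpos t ht'), ← EReal.coe_sub, sub_neg_eq_add]
    rw [e]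
    exact_mod_cast sum_regret_le hd hT hR hV hpos
  · -- A comparator with an infinite loss has regret `-∞`, as the played losses are finite.
    push Not at hpos
    obtain ⟨t, ht, h0⟩ := hpos
    have h1 : ip V (R t) = 0 := le_antisymm h0 (ip_nonneg hV.1 (hR t ht).1)
    have h2 : loss (play T R t) (R t) - loss V (R t) = ⊥ := by
      rw [hplay t ht, loss, h1, negLog_zero, EReal.sub_top]
    rw [← Finset.add_sum_erase _ _ (Finset.mem_range.2 ht), h2, EReal.bot_add]
    exact bot_le

end Algorithm

end QuantumBISONS

end

theorem mainTheorem4 :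
    ∃ C : ℝ, ∀ (d T : ℕ), 1 ≤ d → 110 * d ^ 2 ≤ T →
      ∀ R : ℕ → QuantumBISONS.Mat d, (∀ t < T, R t ∈ QuantumBISONS.states d) →
        QuantumBISONS.regret T R ≤ ((C * (d : ℝ) ^ 3 * Real.log T ^ 2 : ℝ) : EReal) := by
  exact ⟨417, fun d T hd hT R hR => iSup₂_le fun V hV =>
    QuantumBISONS.regretAgainst_le hd hT hR hV⟩
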